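/- Let $X\ge 0$ be a (real-valued) task execution time with distribution function $F_X$ and tail $\bar F_X=1-F_X$, and let $0<p<1$, $r\in\{0,1,2,\dots\}$, $l\in\{0,1\}$ be the parameters of a single-fork replication policy. For a distribution function $F$ write $F^{-1}(u)=\inf\{x: F(x)\ge u\}$ for $0<u<1$, and let $x_F=\sup\{x:F(x)<1\}\in(-\infty,\infty]$ be its upper end point. Let $F_Y=1-\bar F_Y$ be the distribution function of the residual execution time of a straggling task, given by $\bar F_Y(y)=1$ for $y<0$ and, for $y\ge 0$, $$\bar F_Y(y)=\begin{cases}\bar F_X(y)^{r+1}, & l=0,\\ \tfrac1p\,\bar F_X(y)^r\,\bar F_X\big(y+F_X^{-1}(1-p)\big), & l=1.\end{cases}$$ Let $Y_{m:m}$ be the maximum of $m$ i.i.d. random variables with distribution function $F_Y$. Say that $F_Y\in \mathrm{DA}(G)$ if there are $a_n>0$ and $b_n\in\mathbb R$ with $F_Y(a_nx+b_n)^n\to G(x)$ for all $x\in\mathbb R$, i.e. $(Y_{n:n}-b_n)/a_n$ converges in law to $G$. Let $\Lambda(x)=\exp(-e^{-x})$; for $\alpha>0$ let $\Phi_\alpha(x)=\exp(-x^{-\alpha})$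 for $x>0$ and $\Phi_\alpha(x)=0$ for $x\le0$, and let $\Psi_\alpha(x)=\exp(-(-x)^\alpha)$ for $x<0$ and $\Psi_\alpha(x)=1$ for $x\ge 0$. Let $\Gamma(t)=\int_0^\infty x^{t-1}e^{-x}\,dx\in(0,\infty]$, which is $+\infty$ for $t\le0$, and let $\gamma_{\rm EM}$ be the Euler–Mascheroni constant. Below, $n\to\infty$, and $pn$ is replaced by $\lfloor pn\rfloor$ when it is not an integer. 1. (Gumbel) If $F_Y\in \mathrm{DA}(\Lambda)$, then there is a function $\eta$, positive on $(-\infty,x_{F_Y})$, such that $\bar F_Y(x+t\eta(x))/\bar F_Y(x)\to e^{-t}$ as $x\to x_{F_Y}^-$ for every $t\in\mathbb R$. The maxima $Y_{pn:pn}$ are integrable, and for every such $\eta$, with $\tilde b_m=F_Y^{-1}(1-1/m)$ and $\tilde a_m=\eta(\tilde b_m)$, one has $\tilde a_m>0$ for all large $m$ and $$\mathbb E[Y_{pn:pn}]=\tilde a_{pn}\gamma_{\rm EM}+\tilde b_{pn}+o(\tilde a_{pn}).$$ 2. (Fréchet) If $\xi>0$ and $F_Y\in \mathrm{DA}(\Phi_{(r+1)\xi})$,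 then with $\tilde a_m=F_Y^{-1}(1-1/m)$ one has $\tilde a_m>0$ for all large $m$ and $$\frac{\mathbb E[Y_{pn:pn}]}{\tilde a_{pn}}\longrightarrow\Gamma\Big(1-\frac1{(r+1)\xi}\Big)\quad\text{in }[0,\infty];$$ if $(r+1)\xi>1$, then the maxima $Y_{pn:pn}$ are integrable and the limit is finite, while for $(r+1)\xi\le1$ the limit is $+\infty$. 3. (Reversed Weibull) If $\xi>0$ and $F_Y\in \mathrm{DA}(\Psi_{((1-l)r+1)\xi})$, then $x_{F_Y}<\infty$, the maxima $Y_{pn:pn}$ are integrable, and with $\tilde a_m=x_{F_Y}-F_Y^{-1}(1-1/m)$ one has $\tilde a_m>0$ for all large $m$ and $$\mathbb E[Y_{pn:pn}]=x_{F_Y}-\tilde a_{pn}\,\Gamma\Big(1+\frac1{((1-l)r+1)\xi}\Big)+o(\tilde a_{pn}).$$ -/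

import Mathlib

open MeasureTheory ProbabilityTheory Filter Topology Set

noncomputable section

namespace SingleFork

/-- Upper end point `sup {x : F x < 1}` of a distribution function, in `[-∞, ∞]`. -/
def upperEndpoint (F : ℝ → ℝ) : EReal :=
  sSup ((fun x : ℝ => (x : EReal)) '' {x : ℝ | F x < 1})

/-- The (left-continuous) inverse `F⁻¹(u) = inf {x : F x ≥ u}` of a distribution function,
meant for `0 < u < 1`. -/
def quantile (F : ℝ → ℝ) (u : ℝ) : ℝ := sInf {x : ℝ | u ≤ F x}

/-- The Gumbel distribution function `Λ`. -/
def gumbelCDF (x : ℝ) : ℝ := Real.exp (-Real.exp (-x))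

/-- The Fréchet distribution function `Φ_ξ`. -/
def frechetCDF (ξ x : ℝ) : ℝ := if x ≤ 0 then 0 else Real.exp (-(x ^ (-ξ)))

/-- The reversed-Weibull distribution function `Ψ_ξ`. -/
def reversedWeibullCDF (ξ x : ℝ) : ℝ := if x < 0 then Real.exp (-((-x) ^ ξ)) else 1

/-- `F` lies in the domain of attraction of the (continuous) distribution function `G`: for some
`a n > 0` and `b n`, the normalized maximum `(X_{n:n} - b n) / a n` of `n` i.i.d. draws from `F`,
whose distribution function at `x` is `F (a n * x + b n) ^ n`, converges in law to `G`. -/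
def InDomainOfAttraction (F G : ℝ → ℝ) : Prop :=
  ∃ a b : ℕ → ℝ, (∀ n, 0 < a n) ∧
    ∀ x : ℝ, Tendsto (fun n : ℕ => F (a n * x + b n) ^ n) atTop (𝓝 (G x))

/-- `η` is an auxiliary function of `F`: it is positive below the upper end point `x_F`, and
`(1 - F (x + t η(x))) / (1 - F x) → exp (-t)` as the real number `x` tends to `x_F ≤ ∞` from the
left, for every real `t`. -/
def IsAuxiliaryFunction (F η : ℝ → ℝ) : Prop :=
  (∀ x : ℝ, (x : EReal) < upperEndpoint F → 0 < η x) ∧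
    ∀ t : ℝ, Tendsto (fun x : ℝ => (1 - F (x + t * η x)) / (1 - F x))
      (comap (fun x : ℝ => (x : EReal)) (𝓝[<] (upperEndpoint F))) (𝓝 (Real.exp (-t)))

/-- The tail `1 - F_Y` of the residual execution time of a straggling task after forking, under the
single-fork policy with parameters `p`, `r`, `l`, when `F` is the distribution function of the
(nonnegative) execution time.  A residual time is nonnegative, so the tail is `1` at `y < 0`. -/
def residualTail (F : ℝ → ℝ) (p : ℝ) (r l : ℕ) (y : ℝ) : ℝ :=
  if y < 0 then 1
  else if l = 0 then (1 - F y) ^ (r + 1)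
  else 1 / p * (1 - F y) ^ r * (1 - F (y + quantile F (1 - p)))

/-- The distribution function `F_Y` of the residual execution time. -/
def residualCDF (F : ℝ → ℝ) (p : ℝ) (r l : ℕ) (y : ℝ) : ℝ := 1 - residualTail F p r l y

/-- The number `pn` of straggling tasks (rounded down if `pn` is not an integer). -/
def stragglers (p : ℝ) (n : ℕ) : ℕ := ⌊p * n⌋₊

/-- The largest order statistic `Y_{m:m}` of `Y_1, …, Y_m`. -/
def sampleMax {Ω : Type*} {m : ℕ} (Y : Fin m → Ω → ℝ) (ω : Ω) : ℝ := ⨆ i, Y i ω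

/-- `Y_1, …, Y_m` are i.i.d. random variables with distribution function `F`. -/
structure IsIIDSample {Ω : Type*} [MeasurableSpace Ω] (μ : Measure Ω) (F : ℝ → ℝ) {m : ℕ}
    (Y : Fin m → Ω → ℝ) : Prop where
  measurable : ∀ i, Measurable (Y i)
  indep : iIndepFun Y μ
  cdf_eq : ∀ i y, cdf (μ.map (Y i)) y = F y

/-- The integral `∫₀^∞ x ^ (t - 1) e ^ (-x) dx` defining `Γ(t)`, with values in `[0, ∞]`;
it is `∞` for `t ≤ 0`. -/
def gammaIntegral (t : ℝ) : ENNReal :=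
  ∫⁻ x in Ioi (0 : ℝ), ENNReal.ofReal (x ^ (t - 1) * Real.exp (-x))

end SingleFork

end

/-!
Everything is expressed through the tail `T = 1 - F_Y`, which is shown to be the tail of a
nonnegative random variable; after that the particular form of `F_Y` plays no role.

Attraction to `G` means `n T(aₙ s + bₙ) → -log G(s)`. Writing a point `x` near the upper end point
as `aₙ s + bₙ` with `n = ⌊1 / T x⌋` turns this into a statement in the continuous variable `x`: with
`η(x) = aₙ`, the ratio `T(x + t η(x)) / T(x)` has the limit `L(t)`, equal to `exp (-t)`,
`(1 + t) ^ (-α)` or `(1 - t) ^ α` (`hasTailLimit_of_norming`). The functional equation of `L`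
determines how `η` varies under the shift `x ↦ x + t η(x)` (`tendsto_aux_shift`). Iterating shifts
shows that `η(x) ~ x` with infinite end point in the Fréchet case (`hasTailLimit_id`) and
`η(x) ~ x_F - x` with finite end point `x_F` in the reversed Weibull case
(`exists_endpoint_of_reversedWeibull`).

At the quantile `b` of order `1 - 1 / m` one has `m T(b) → 1`, so the distribution function
`F(b + t η(b)) ^ m` of the normalized maximum converges (`tendsto_pow_quantile`). The same iteration
of shifts yields polynomial bounds on `T` on the scale `η` (`eventually_tail_le`,
`eventually_le_tail`), and these dominate the two integrals that express the normalized expectation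
(`tendsto_integral_sub_integral`). The limit is the expectation of the extreme value law, computed
by realizing this law as a function of an exponential random variable. In the Fréchet case with
`α ≤ 1` Fatou's lemma gives divergence.
-/

namespace SingleFork

/-! ### Limits of monotone functions -/

/-- Antitone functions that converge pointwise to a continuous function converge along moving
arguments too. -/
theorem tendsto_antitone_comp {ι : Type*} {l : Filter ι} {f : ι → ℝ → ℝ} {g : ℝ → ℝ} {S : Set ℝ}
    (hS : IsOpen S) (hf : ∀ᶠ i in l, Antitone (f i))
    (h : ∀ s ∈ S, Tendsto (fun i => f i s) l (𝓝 (g s))) {s₀ : ℝ} (hs : s₀ ∈ S)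
    (hg : ContinuousAt g s₀) {σ : ι → ℝ} (hσ : Tendsto σ l (𝓝 s₀)) :
    Tendsto (fun i => f i (σ i)) l (𝓝 (g s₀)) := by
  refine tendsto_order.2 ⟨fun c hc => ?_, fun c hc => ?_⟩
  · have h1 : ∀ᶠ s in 𝓝[>] s₀, c < g s ∧ s ∈ S ∧ s₀ < s :=
      Eventually.and (nhdsWithin_le_nhds (hg.eventually (lt_mem_nhds hc)))
        (Eventually.and (nhdsWithin_le_nhds (hS.mem_nhds hs)) self_mem_nhdsWithin)
    obtain ⟨s, hcs, hsS, hlt⟩ := h1.exists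
    filter_upwards [hf, (h s hsS).eventually (lt_mem_nhds hcs), hσ.eventually (gt_mem_nhds hlt)]
      with i hi h2 h3
    exact h2.trans_le (hi h3.le)
  · have h1 : ∀ᶠ s in 𝓝[<] s₀, g s < c ∧ s ∈ S ∧ s < s₀ :=
      Eventually.and (nhdsWithin_le_nhds (hg.eventually (gt_mem_nhds hc)))
        (Eventually.and (nhdsWithin_le_nhds (hS.mem_nhds hs)) self_mem_nhdsWithin)
    obtain ⟨s, hcs, hsS, hlt⟩ := h1.exists
    filter_upwards [hf, (h s hsS).eventually (gt_mem_nhds hcs), hσ.eventually (lt_mem_nhds hlt)]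
      with i hi h2 h3
    exact (hi h3.le).trans_lt h2

/-- Conversely, if the values converge to the value of a strictly decreasing limit function at an
interior point, the arguments converge to this point. -/
theorem tendsto_arg_of_tendsto_antitone {ι : Type*} {l : Filter ι} {f : ι → ℝ → ℝ} {g : ℝ → ℝ}
    {S : Set ℝ} (hS : IsOpen S) (hf : ∀ᶠ i in l, Antitone (f i))
    (h : ∀ s ∈ S, Tendsto (fun i => f i s) l (𝓝 (g s))) (hg : StrictAntiOn g S) {s₀ : ℝ}
    (hs : s₀ ∈ S) {σ : ι → ℝ} (hσ : Tendsto (fun i => f i (σ i)) l (𝓝 (g s₀))) :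
    Tendsto σ l (𝓝 s₀) := by
  refine tendsto_order.2 ⟨fun c hc => ?_, fun c hc => ?_⟩
  · have h1 : ∀ᶠ s in 𝓝[<] s₀, c < s ∧ s ∈ S ∧ s < s₀ :=
      Eventually.and (nhdsWithin_le_nhds (lt_mem_nhds hc))
        (Eventually.and (nhdsWithin_le_nhds (hS.mem_nhds hs)) self_mem_nhdsWithin)
    obtain ⟨s, hcs, hsS, hlt⟩ := h1.exists
    obtain ⟨d, hd1, hd2⟩ := exists_between (hg hsS hs hlt)
    filter_upwards [hf, (h s hsS).eventually (lt_mem_nhds hd2), hσ.eventually (gt_mem_nhds hd1)]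
      with i hi h2 h3
    by_contra! hle
    exact absurd (hi (hle.trans hcs.le)) (not_le.2 (h3.trans h2))
  · have h1 : ∀ᶠ s in 𝓝[>] s₀, s < c ∧ s ∈ S ∧ s₀ < s :=
      Eventually.and (nhdsWithin_le_nhds (gt_mem_nhds hc))
        (Eventually.and (nhdsWithin_le_nhds (hS.mem_nhds hs)) self_mem_nhdsWithin)
    obtain ⟨s, hcs, hsS, hlt⟩ := h1.exists
    obtain ⟨d, hd1, hd2⟩ := exists_between (hg hs hsS hlt)
    filter_upwards [hf, (h s hsS).eventually (gt_mem_nhds hd1), hσ.eventually (lt_mem_nhds hd2)]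
      with i hi h2 h3
    by_contra! hle
    exact absurd (hi (hcs.le.trans hle)) (not_le.2 (h2.trans h3))

/-- If `xₙⁿ → g > 0` with `0 ≤ xₙ`, then `n (1 - xₙ) → -log g`. -/
theorem tendsto_mul_one_sub_of_pow {x : ℕ → ℝ} (h0 : ∀ n, 0 ≤ x n) {g : ℝ}
    (hg : 0 < g) (h : Tendsto (fun n => x n ^ n) atTop (𝓝 g)) :
    Tendsto (fun n : ℕ => (n : ℝ) * (1 - x n)) atTop (𝓝 (-Real.log g)) := by
  have hlog : Tendsto (fun n : ℕ => (n : ℝ) * Real.log (x n)) atTop (𝓝 (Real.log g)) := by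
    simpa [Real.log_pow] using h.log hg.ne'
  have hpos : ∀ᶠ n in atTop, 0 < x n := by
    filter_upwards [h.eventually (lt_mem_nhds hg), eventually_ge_atTop 1] with n hn h1n
    refine (h0 n).lt_of_ne' fun h0 => ?_
    rw [h0, zero_pow (by omega)] at hn
    exact lt_irrefl _ hn
  have hl0 : Tendsto (fun n : ℕ => Real.log (x n)) atTop (𝓝 0) := by
    have := hlog.mul (tendsto_inv_atTop_nhds_zero_nat (𝕜 := ℝ))
    rw [mul_zero] at this
    refine this.congr' ?_
    filter_upwards [eventually_ge_atTop 1] with n hn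
    have : (n : ℝ) ≠ 0 := by positivity
    field_simp
  have hx1 : Tendsto x atTop (𝓝 1) := by
    have := (Real.continuous_exp.tendsto 0).comp hl0
    rw [Real.exp_zero] at this
    refine this.congr' ?_
    filter_upwards [hpos] with n hn
    exact Real.exp_log hn
  have hlow : Tendsto (fun n : ℕ => x n * -((n : ℝ) * Real.log (x n))) atTop
      (𝓝 (-Real.log g)) := by
    simpa using hx1.mul hlog.neg
  refine tendsto_of_tendsto_of_tendsto_of_le_of_le' hlow hlog.neg ?_ ?_
  · filter_upwards [hpos] with n hn
    have h2 := Real.one_sub_inv_le_log_of_pos hn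
    have h3 : x n * (1 - (x n)⁻¹) = x n - 1 := by field_simp
    have h4 := mul_le_mul_of_nonneg_left h2 hn.le
    rw [h3] at h4
    nlinarith [(Nat.cast_nonneg n : (0 : ℝ) ≤ n)]
  · filter_upwards [hpos] with n hn
    have h2 := Real.log_le_sub_one_of_pos hn
    nlinarith [(Nat.cast_nonneg n : (0 : ℝ) ≤ n)]

/-! ### Tail functions near the end point -/

/-- `T` is the tail `1 - F` of the distribution function `F` of a nonnegative random variable. -/
structure IsTailFunction (T : ℝ → ℝ) : Prop where
  antitone : Antitone T
  right_cont : ∀ x, ContinuousWithinAt T (Ici x) x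
  eq_one_of_neg : ∀ x < 0, T x = 1
  tendsto_zero : Tendsto T atTop (𝓝 0)

/-- The filter of the arguments `x` with `T x` positive and tending to `0`. If `T` takes arbitrarily
small positive values, this is the filter of left neighbourhoods of the upper end point, finite or
not, and it has the advantage of being defined without mention of that point. -/
def tailFilter (T : ℝ → ℝ) : Filter ℝ := comap T (𝓝[>] 0)

/-- `T` takes arbitrarily small positive values: the distribution has no atom at its upper end
point. -/
def HasSmallValues (T : ℝ → ℝ) : Prop := ∀ ε > 0, ∃ x, 0 < T x ∧ T x < ε

/-- `T (x + t η(x)) / T x → L t` at the upper end point, for all `t ∈ D`; the auxiliary function `η`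
is positive near the end point. -/
structure HasTailLimit (T η : ℝ → ℝ) (D : Set ℝ) (L : ℝ → ℝ) : Prop where
  pos : ∀ᶠ x in tailFilter T, 0 < η x
  tendsto : ∀ t ∈ D, Tendsto (fun x => T (x + t * η x) / T x) (tailFilter T) (𝓝 (L t))

namespace IsTailFunction

variable {T : ℝ → ℝ}

theorem nonneg (hT : IsTailFunction T) (x : ℝ) : 0 ≤ T x :=
  hT.antitone.le_of_tendsto hT.tendsto_zero x

theorem le_one (hT : IsTailFunction T) (x : ℝ) : T x ≤ 1 := by
  rw [← hT.eq_one_of_neg (min x (-1)) (by simp)]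
  exact hT.antitone (min_le_left _ _)

theorem eventually_tailFilter (hT : IsTailFunction T) (hs : HasSmallValues T) {P : ℝ → Prop} :
    (∀ᶠ x in tailFilter T, P x) ↔ ∃ X, 0 < T X ∧ ∀ x, X ≤ x → 0 < T x → P x := by
  have hb : (tailFilter T).HasBasis (fun ε : ℝ => 0 < ε) fun ε => T ⁻¹' Ioo 0 ε :=
    (nhdsGT_basis (0 : ℝ)).comap T
  rw [hb.eventually_iff]
  constructor
  · rintro ⟨ε, hε, h⟩
    obtain ⟨X, hX, hXε⟩ := hs ε hε
    exact ⟨X, hX, fun x hx h0 => h ⟨h0, (hT.antitone hx).trans_lt hXε⟩⟩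
  · rintro ⟨X, hX, h⟩
    refine ⟨T X, hX, fun x hx => h x ?_ hx.1⟩
    by_contra! hlt
    exact absurd (hT.antitone hlt.le) (not_le.2 hx.2)

theorem neBot_tailFilter (hT : IsTailFunction T) (hs : HasSmallValues T) :
    (tailFilter T).NeBot := by
  refine ⟨fun h => ?_⟩
  have : ∀ᶠ x in tailFilter T, False := by simp [h]
  obtain ⟨X, hX, h⟩ := (hT.eventually_tailFilter hs).1 this
  exact h X le_rfl hX

theorem eventually_gt_tailFilter (hT : IsTailFunction T) {X : ℝ} (hX : 0 < T X) :
    ∀ᶠ x in tailFilter T, X < x := by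
  have : ∀ᶠ y in 𝓝[>] (0 : ℝ), y < T X := nhdsWithin_le_nhds (gt_mem_nhds hX)
  filter_upwards [tendsto_comap.eventually this] with x hx
  by_contra! hle
  exact absurd (hT.antitone hle) (not_le.2 hx)

theorem eventually_nonneg_tailFilter (hT : IsTailFunction T) : ∀ᶠ x in tailFilter T, 0 ≤ x := by
  have : ∀ᶠ y in 𝓝[>] (0 : ℝ), y < 1 := nhdsWithin_le_nhds (gt_mem_nhds one_pos)
  filter_upwards [tendsto_comap.eventually this] with x hx
  by_contra! hle
  rw [hT.eq_one_of_neg x hle] at hx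
  exact lt_irrefl _ hx

theorem _root_.SingleFork.eventually_pos_tailFilter : ∀ᶠ x in tailFilter T, 0 < T x :=
  tendsto_comap.eventually self_mem_nhdsWithin

/-- By right continuity the points with positive tail have no largest element. -/
theorem exists_gt_pos (hT : IsTailFunction T) {x : ℝ} (hx : 0 < T x) : ∃ y, x < y ∧ 0 < T y := by
  have h1 : ∀ᶠ y in 𝓝[>] x, 0 < T y :=
    ((hT.right_cont x).mono Ioi_subset_Ici_self).eventually (lt_mem_nhds hx)
  obtain ⟨y, h, hy⟩ := (h1.and self_mem_nhdsWithin).exists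
  exact ⟨y, hy, h⟩

/-- The shifted argument `x + t η(x)` tends to the end point with `x` if the limit at `t` is
positive. -/
theorem _root_.SingleFork.HasTailLimit.tendsto_shift {η L : ℝ → ℝ} {D : Set ℝ}
    (h : HasTailLimit T η D L) {t : ℝ} (ht : t ∈ D)
    (hL : 0 < L t) : Tendsto (fun x => x + t * η x) (tailFilter T) (tailFilter T) := by
  refine tendsto_comap_iff.2 ?_
  have h1 : Tendsto (fun x => T (x + t * η x) / T x * T x) (tailFilter T) (𝓝 (L t * 0)) :=
    (h.tendsto t ht).mul (tendsto_comap.mono_right nhdsWithin_le_nhds)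
  rw [mul_zero] at h1
  refine tendsto_nhdsWithin_iff.2 ⟨h1.congr' ?_, ?_⟩
  · filter_upwards [eventually_pos_tailFilter (T := T)] with x hx
    exact div_mul_cancel₀ _ hx.ne'
  · filter_upwards [eventually_pos_tailFilter (T := T),
      (h.tendsto t ht).eventually (lt_mem_nhds hL)] with x hx h2
    exact (div_pos_iff_of_pos_right hx).1 h2

theorem _root_.SingleFork.HasTailLimit.map_zero {η L : ℝ → ℝ} {D : Set ℝ}
    (h : HasTailLimit T η D L) (h0 : 0 ∈ D) [(tailFilter T).NeBot] : L 0 = 1 := by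
  refine tendsto_nhds_unique (h.tendsto 0 h0) (tendsto_const_nhds.congr' ?_)
  filter_upwards [eventually_pos_tailFilter (T := T)] with x hx
  simp [hx.ne']

theorem eventually_antitone (hT : IsTailFunction T) {η : ℝ → ℝ}
    (h : ∀ᶠ x in tailFilter T, 0 < η x) :
    ∀ᶠ x in tailFilter T, Antitone fun t => T (x + t * η x) / T x := by
  filter_upwards [h, eventually_pos_tailFilter (T := T)] with x h1 h2 s t hst
  have := hT.antitone (show x + s * η x ≤ x + t * η x by gcongr)
  exact div_le_div_of_nonneg_right this h2.le

/-- The auxiliary function may be replaced by an asymptotically equal one. -/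
theorem hasTailLimit_congr (hT : IsTailFunction T) {η η' L : ℝ → ℝ} {D : Set ℝ} (hD : IsOpen D)
    (h : HasTailLimit T η D L) (hL : ContinuousOn L D) (hη' : ∀ᶠ x in tailFilter T, 0 < η' x)
    (hr : Tendsto (fun x => η' x / η x) (tailFilter T) (𝓝 1)) : HasTailLimit T η' D L := by
  refine ⟨hη', fun t ht => ?_⟩
  have h1 := tendsto_antitone_comp hD (hT.eventually_antitone h.pos) h.tendsto ht
    (hL.continuousAt (hD.mem_nhds ht)) (σ := fun x => t * (η' x / η x))
    (by simpa using hr.const_mul t)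
  refine h1.congr' ?_
  filter_upwards [h.pos] with x hx
  rw [mul_assoc, div_mul_cancel₀ _ hx.ne']

/-- The auxiliary function varies along shifts as the functional equation of the limit dictates:
both sides of `L u * L t = L v` are limits of tail ratios, over two steps `t η(x)`, `u η(x + t η(x))` and
one step `v η(x)`, so the total displacements agree asymptotically. -/
theorem tendsto_aux_shift (hT : IsTailFunction T) {η L : ℝ → ℝ} {D : Set ℝ} (hD : IsOpen D)
    (h : HasTailLimit T η D L) (hL : StrictAntiOn L D) {t u v : ℝ} (ht : t ∈ D) (hu : u ∈ D)
    (hv : v ∈ D) (hLt : 0 < L t) (hu0 : u ≠ 0) (huv : L u * L t = L v) :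
    Tendsto (fun x => η (x + t * η x) / η x) (tailFilter T) (𝓝 ((v - t) / u)) := by
  have hsh := h.tendsto_shift ht hLt
  have h1 := ((h.tendsto u hu).comp hsh).mul (h.tendsto t ht)
  rw [huv] at h1
  have h2 := tendsto_arg_of_tendsto_antitone hD (hT.eventually_antitone h.pos) h.tendsto hL hv
    (σ := fun x => t + u * (η (x + t * η x) / η x)) (by
      refine h1.congr' ?_
      filter_upwards [h.pos, hsh.eventually eventually_pos_tailFilter] with x h3 h4
      simp only [Function.comp]
      rw [div_mul_div_cancel₀ h4.ne']
      congr 2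
      field_simp
      ring)
  refine ((h2.sub_const t).div_const u).congr fun x => ?_
  field_simp
  ring

/-- By right continuity the tail vanishes at a finite upper end point. -/
theorem coe_lt_upperEndpoint_iff (hT : IsTailFunction T) {F : ℝ → ℝ}
    (hF : ∀ x, F x = 1 - T x) (x : ℝ) : (x : EReal) < upperEndpoint F ↔ 0 < T x := by
  rw [upperEndpoint, lt_sSup_iff]
  constructor
  · rintro ⟨_, ⟨y, hy, rfl⟩, hxy⟩
    have hy : F y < 1 := hy
    rw [hF] at hy
    have := hT.antitone (EReal.coe_lt_coe_iff.1 hxy).le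
    linarith
  · intro hx
    obtain ⟨y, hxy, hy⟩ := hT.exists_gt_pos hx
    exact ⟨y, ⟨y, by simp [hF, hy], rfl⟩, EReal.coe_lt_coe_iff.2 hxy⟩

theorem comap_nhdsLT_eq_tailFilter (hT : IsTailFunction T) (hs : HasSmallValues T)
    {F : ℝ → ℝ} (hF : ∀ x, F x = 1 - T x) :
    comap (fun x : ℝ => (x : EReal)) (𝓝[<] (upperEndpoint F)) = tailFilter T := by
  obtain ⟨X₀, hX₀, -⟩ := hs 1 one_pos
  have hb := (nhdsLT_basis_of_exists_lt
    ⟨_, (hT.coe_lt_upperEndpoint_iff hF X₀).2 hX₀⟩).comap (fun x : ℝ => (x : EReal))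
  ext s
  change (∀ᶠ x in _, x ∈ s) ↔ ∀ᶠ x in _, x ∈ s
  rw [hT.eventually_tailFilter hs, hb.eventually_iff]
  constructor
  · rintro ⟨a, ha, h⟩
    obtain ⟨X, haX, hX⟩ := EReal.lt_iff_exists_real_btwn.1 ha
    refine ⟨X, (hT.coe_lt_upperEndpoint_iff hF X).1 hX, fun x hx h0 => h ⟨?_, ?_⟩⟩
    · exact haX.trans_le (EReal.coe_le_coe_iff.2 hx)
    · exact (hT.coe_lt_upperEndpoint_iff hF x).2 h0
  · rintro ⟨X, hX, h⟩
    refine ⟨X, (hT.coe_lt_upperEndpoint_iff hF X).2 hX, fun x hx => h x ?_ ?_⟩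
    · exact (EReal.coe_lt_coe_iff.1 hx.1).le
    · exact (hT.coe_lt_upperEndpoint_iff hF x).1 hx.2

end IsTailFunction

/-! ### From a domain of attraction to an auxiliary function -/

namespace IsTailFunction

variable {T : ℝ → ℝ}

theorem hasSmallValues_of_tendsto {y : ℕ → ℝ} {c : ℝ} (hc : 0 < c)
    (h : Tendsto (fun n : ℕ => (n : ℝ) * T (y n)) atTop (𝓝 c)) : HasSmallValues T := by
  intro ε hε
  have h1 : Tendsto (fun n : ℕ => (n : ℝ) * T (y n) * (n : ℝ)⁻¹) atTop (𝓝 (c * 0)) :=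
    h.mul (tendsto_inv_atTop_nhds_zero_nat (𝕜 := ℝ))
  rw [mul_zero] at h1
  obtain ⟨n, h2, h3, h4⟩ := ((h1.eventually (gt_mem_nhds hε)).and
    ((h.eventually (lt_mem_nhds hc)).and (eventually_gt_atTop 0))).exists
  have hn : (0 : ℝ) < n := Nat.cast_pos.2 h4
  refine ⟨y n, (pos_iff_pos_of_mul_pos h3).1 hn, ?_⟩
  rwa [mul_comm (n : ℝ), mul_assoc, mul_inv_cancel₀ hn.ne', mul_one] at h2

/-- If `n T(aₙ s + bₙ) → τ s`, then the norming constant `aₙ` with `n = ⌊1 / T x⌋` serves as an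
auxiliary function at `x`: indeed `x = aₙ s + bₙ` for some `s` close to the point where `τ` is
`1`. -/
theorem hasTailLimit_of_norming (hT : IsTailFunction T) {a b : ℕ → ℝ} (ha : ∀ n, 0 < a n)
    {S : Set ℝ} (hS : IsOpen S) {τ : ℝ → ℝ} (hτ : StrictAntiOn τ S) (hτc : ContinuousOn τ S)
    (h : ∀ s ∈ S, Tendsto (fun n : ℕ => (n : ℝ) * T (a n * s + b n)) atTop (𝓝 (τ s)))
    {s₀ : ℝ} (hs₀ : s₀ ∈ S) (h1 : τ s₀ = 1) {D : Set ℝ} (hD : ∀ t ∈ D, s₀ + t ∈ S) :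
    HasTailLimit T (fun x => a ⌊(T x)⁻¹⌋₊) D (fun t => τ (s₀ + t)) := by
  refine ⟨Eventually.of_forall fun x => ha _, fun t ht => ?_⟩
  have hinv : Tendsto (fun x => (T x)⁻¹) (tailFilter T) atTop :=
    tendsto_inv_nhdsGT_zero.comp tendsto_comap
  have hN : Tendsto (fun x => ⌊(T x)⁻¹⌋₊) (tailFilter T) atTop := tendsto_nat_floor_atTop.comp hinv
  have hNT : Tendsto (fun x => (⌊(T x)⁻¹⌋₊ : ℝ) * T x) (tailFilter T) (𝓝 1) := by
    refine (tendsto_nat_floor_div_atTop.comp hinv).congr fun x => ?_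
    simp [div_inv_eq_mul]
  set N : ℝ → ℕ := fun x => ⌊(T x)⁻¹⌋₊ with hNdef
  have hanti : ∀ᶠ x in tailFilter T, Antitone fun s => (N x : ℝ) * T (a (N x) * s + b (N x)) := by
    refine Eventually.of_forall fun x s s' hss => ?_
    have : a (N x) * s + b (N x) ≤ a (N x) * s' + b (N x) := by
      have := mul_le_mul_of_nonneg_left hss (ha (N x)).le
      linarith
    exact mul_le_mul_of_nonneg_left (hT.antitone this) (Nat.cast_nonneg _)
  have hlim : ∀ s ∈ S, Tendsto (fun x => (N x : ℝ) * T (a (N x) * s + b (N x))) (tailFilter T)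
      (𝓝 (τ s)) := fun s hs => (h s hs).comp hN
  have harg : ∀ x, a (N x) * ((x - b (N x)) / a (N x)) + b (N x) = x := fun x => by
    rw [mul_div_cancel₀ _ (ha _).ne']
    ring
  have hσ : Tendsto (fun x => (x - b (N x)) / a (N x)) (tailFilter T) (𝓝 s₀) := by
    refine tendsto_arg_of_tendsto_antitone hS hanti hlim hτ hs₀ ?_
    rw [h1]
    simpa only [harg] using hNT
  have hfin := (tendsto_antitone_comp hS hanti hlim (hD t ht)
    (hτc.continuousAt (hS.mem_nhds (hD t ht))) (hσ.add_const t)).div hNT one_ne_zero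
  rw [div_one] at hfin
  refine hfin.congr' ?_
  filter_upwards [hNT.eventually (lt_mem_nhds one_pos)] with x hx
  have hNx : (N x : ℝ) ≠ 0 := fun h0 => by
    simp only [hNdef] at h0
    simp [h0] at hx
  have harg' : a (N x) * ((x - b (N x)) / a (N x) + t) + b (N x) = x + t * a (N x) := by
    linear_combination harg x
  simp only [Pi.div_apply, harg']
  exact mul_div_mul_left _ _ hNx

/-- The tail form `n T(aₙ s + bₙ) → -log G(s)` of attraction to `G`. -/
theorem tendsto_of_pow (hT : IsTailFunction T) {F G : ℝ → ℝ} (hF : ∀ x, F x = 1 - T x)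
    {a b : ℕ → ℝ} (h : ∀ x, Tendsto (fun n : ℕ => F (a n * x + b n) ^ n) atTop (𝓝 (G x))) {s : ℝ}
    (hs : 0 < G s) :
    Tendsto (fun n : ℕ => (n : ℝ) * T (a n * s + b n)) atTop (𝓝 (-Real.log (G s))) := by
  have := tendsto_mul_one_sub_of_pow (x := fun n => F (a n * s + b n))
    (fun n => by rw [hF]; linarith [hT.le_one (a n * s + b n)]) hs (h s)
  simpa [hF] using this

theorem exists_aux_gumbel (hT : IsTailFunction T) {F : ℝ → ℝ} (hF : ∀ x, F x = 1 - T x)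
    (h : InDomainOfAttraction F gumbelCDF) :
    HasSmallValues T ∧ ∃ η, HasTailLimit T η univ fun t => Real.exp (-t) := by
  obtain ⟨a, b, ha, hab⟩ := h
  have h1 : ∀ s ∈ (univ : Set ℝ), Tendsto (fun n : ℕ => (n : ℝ) * T (a n * s + b n)) atTop
      (𝓝 (Real.exp (-s))) := fun s _ => by
    simpa [gumbelCDF] using hT.tendsto_of_pow hF hab (s := s) (Real.exp_pos _)
  refine ⟨hasSmallValues_of_tendsto (Real.exp_pos _) (h1 0 trivial), fun x => a ⌊(T x)⁻¹⌋₊, ?_⟩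
  simpa using hT.hasTailLimit_of_norming ha isOpen_univ
    (fun s _ t _ hst => Real.exp_lt_exp.2 (neg_lt_neg hst))
    (Real.continuous_exp.comp continuous_neg).continuousOn h1 (mem_univ 0) (by simp)
    (D := univ) (fun _ _ => trivial)

theorem exists_aux_frechet (hT : IsTailFunction T) {F : ℝ → ℝ} (hF : ∀ x, F x = 1 - T x) {α : ℝ}
    (hα : 0 < α) (h : InDomainOfAttraction F (frechetCDF α)) :
    HasSmallValues T ∧ ∃ η, HasTailLimit T η (Ioi (-1)) fun t => (1 + t) ^ (-α) := by
  obtain ⟨a, b, ha, hab⟩ := h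
  have h1 : ∀ s ∈ Ioi (0 : ℝ), Tendsto (fun n : ℕ => (n : ℝ) * T (a n * s + b n)) atTop
      (𝓝 (s ^ (-α))) := fun s hs => by
    have hs : 0 < s := hs
    have hG : frechetCDF α s = Real.exp (-(s ^ (-α))) := by simp [frechetCDF, not_le.2 hs]
    have := hT.tendsto_of_pow hF hab (s := s) (hG ▸ Real.exp_pos _)
    rwa [hG, Real.log_exp, neg_neg] at this
  refine ⟨hasSmallValues_of_tendsto (by simp) (h1 1 (mem_Ioi.2 one_pos)), fun x => a ⌊(T x)⁻¹⌋₊, ?_⟩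
  refine hT.hasTailLimit_of_norming ha isOpen_Ioi ?_ ?_ h1 (s₀ := 1) (mem_Ioi.2 one_pos) (by simp)
    fun t ht => ?_
  · exact fun s hs t _ hst => Real.rpow_lt_rpow_of_neg hs hst (neg_neg_of_pos hα)
  · exact fun s hs => (Real.continuousAt_rpow_const s _ (Or.inl (ne_of_gt hs))).continuousWithinAt
  · have ht : -1 < t := ht
    exact mem_Ioi.2 (by linarith)

theorem exists_aux_reversedWeibull (hT : IsTailFunction T) {F : ℝ → ℝ} (hF : ∀ x, F x = 1 - T x)
    {α : ℝ} (hα : 0 < α) (h : InDomainOfAttraction F (reversedWeibullCDF α)) :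
    HasSmallValues T ∧ ∃ η, HasTailLimit T η (Iio 1) fun t => (1 - t) ^ α := by
  obtain ⟨a, b, ha, hab⟩ := h
  have h1 : ∀ s ∈ Iio (0 : ℝ), Tendsto (fun n : ℕ => (n : ℝ) * T (a n * s + b n)) atTop
      (𝓝 ((-s) ^ α)) := fun s hs => by
    have hs : s < 0 := hs
    have hG : reversedWeibullCDF α s = Real.exp (-((-s) ^ α)) := by simp [reversedWeibullCDF, hs]
    have := hT.tendsto_of_pow hF hab (s := s) (hG ▸ Real.exp_pos _)
    rwa [hG, Real.log_exp, neg_neg] at this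
  refine ⟨hasSmallValues_of_tendsto (by simp) (h1 (-1) (by simp)), fun x => a ⌊(T x)⁻¹⌋₊, ?_⟩
  have := hT.hasTailLimit_of_norming ha isOpen_Iio (τ := fun s => (-s) ^ α) (D := Iio 1) ?_ ?_ h1
    (s₀ := -1) (by simp) (by simp) fun t ht => ?_
  · refine ⟨this.pos, fun t ht => ?_⟩
    have h2 := this.tendsto t ht
    rwa [show -(-1 + t) = 1 - t by ring] at h2
  · refine fun s hs t ht hst => Real.rpow_lt_rpow ?_ (neg_lt_neg hst) hα
    have ht : t < 0 := ht
    linarith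
  · exact (continuous_neg.rpow_const fun _ => Or.inr hα.le).continuousOn
  · have ht : t < 1 := ht
    exact mem_Iio.2 (by linarith)

/-! ### Quantiles -/

theorem quantile_spec (hT : IsTailFunction T) {F : ℝ → ℝ} (hF : ∀ x, F x = 1 - T x) {u : ℝ}
    (hu0 : 0 < u) (hu1 : u < 1) :
    T (quantile F u) ≤ 1 - u ∧ ∀ x < quantile F u, 1 - u < T x := by
  have hset : {x : ℝ | u ≤ F x} = {x | T x ≤ 1 - u} := by
    ext x
    simp only [mem_ofPred_eq, hF]
    constructor <;> intro h <;> linarith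
  have hbdd : BddBelow {x | T x ≤ 1 - u} := ⟨0, fun x hx => by
    by_contra! hneg
    rw [mem_ofPred_eq, hT.eq_one_of_neg x hneg] at hx
    linarith⟩
  have hne : {x | T x ≤ 1 - u}.Nonempty :=
    ((hT.tendsto_zero.eventually (gt_mem_nhds (sub_pos.2 hu1))).exists).imp fun x hx => hx.le
  rw [quantile, hset]
  constructor
  · have hgt : ∀ y, sInf {x | T x ≤ 1 - u} < y → T y ≤ 1 - u := fun y hy => by
      obtain ⟨x, hx, hxy⟩ := (csInf_lt_iff hbdd hne).1 hy
      exact (hT.antitone hxy.le).trans hx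
    refine le_of_tendsto ((hT.right_cont _).mono Ioi_subset_Ici_self) ?_
    filter_upwards [self_mem_nhdsWithin] with y hy using hgt y hy
  · intro x hx
    by_contra! hle
    exact absurd (csInf_le hbdd hle) (not_le.2 hx)

theorem quantile_spec_nat (hT : IsTailFunction T) {F : ℝ → ℝ} (hF : ∀ x, F x = 1 - T x) {m : ℕ}
    (hm : 2 ≤ m) : T (quantile F (1 - 1 / (m : ℝ))) ≤ 1 / m ∧
      ∀ x < quantile F (1 - 1 / (m : ℝ)), 1 / (m : ℝ) < T x := by
  have hm' : (2 : ℝ) ≤ m := by exact_mod_cast hm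
  have h1 : 1 / (m : ℝ) < 1 := by
    rw [div_lt_one (by linarith)]
    linarith
  have h2 : 0 < 1 / (m : ℝ) := by positivity
  simpa using hT.quantile_spec hF (u := 1 - 1 / (m : ℝ)) (by linarith) (by linarith)

theorem tendsto_quantile (hT : IsTailFunction T) (hs : HasSmallValues T) {F : ℝ → ℝ}
    (hF : ∀ x, F x = 1 - T x) :
    Tendsto (fun m : ℕ => quantile F (1 - 1 / (m : ℝ))) atTop (tailFilter T) := by
  refine tendsto_comap_iff.2 (tendsto_nhdsWithin_iff.2 ⟨?_, ?_⟩)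
  · refine squeeze_zero' (Eventually.of_forall fun m => hT.nonneg _) ?_
      (tendsto_const_div_atTop_nhds_zero_nat 1)
    filter_upwards [eventually_ge_atTop 2] with m hm using (hT.quantile_spec_nat hF hm).1
  · filter_upwards [eventually_ge_atTop 2] with m hm
    obtain ⟨x, hx0, hx⟩ := hs (1 / m) (by positivity)
    refine hx0.trans_le (hT.antitone ?_)
    by_contra! hlt
    exact absurd ((hT.quantile_spec_nat hF hm).2 x hlt) (not_lt.2 hx.le)

theorem tendsto_mul_quantile (hT : IsTailFunction T) (hs : HasSmallValues T) {F : ℝ → ℝ}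
    (hF : ∀ x, F x = 1 - T x) {η L : ℝ → ℝ} {D : Set ℝ} (h : HasTailLimit T η D L)
    (hD : D ∈ 𝓝 0) (hL : ContinuousAt L 0) :
    Tendsto (fun m : ℕ => (m : ℝ) * T (quantile F (1 - 1 / (m : ℝ)))) atTop (𝓝 1) := by
  have := hT.neBot_tailFilter hs
  have hL0 : L 0 = 1 := h.map_zero (mem_of_mem_nhds hD)
  have hb := hT.tendsto_quantile hs hF
  set b : ℕ → ℝ := fun m => quantile F (1 - 1 / (m : ℝ))
  have hle : ∀ᶠ m : ℕ in atTop, (m : ℝ) * T (b m) ≤ 1 := by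
    filter_upwards [eventually_ge_atTop 2] with m hm
    have h1 := (hT.quantile_spec_nat hF hm).1
    have hm0 : (0 : ℝ) < m := by positivity
    rwa [le_div_iff₀ hm0, mul_comm] at h1
  refine tendsto_order.2 ⟨fun c hc => ?_, fun c hc => ?_⟩
  · -- just below the quantile the tail exceeds `1 / m`, and `L` is close to `1` there
    have h1 : ∀ᶠ t in 𝓝[<] (0 : ℝ), c * L t < 1 ∧ t ∈ D ∧ t < 0 :=
      Eventually.and (nhdsWithin_le_nhds ((continuousAt_const.mul hL).eventually
        (gt_mem_nhds (by simpa [hL0] using hc))))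
        (Eventually.and (nhdsWithin_le_nhds hD) self_mem_nhdsWithin)
    obtain ⟨t, ht1, htD, ht0⟩ := h1.exists
    filter_upwards [(((h.tendsto t htD).comp hb).const_mul c).eventually (gt_mem_nhds ht1),
      hb.eventually h.pos, hb.eventually eventually_pos_tailFilter, eventually_ge_atTop 2]
      with m h2 h3 h4 hm
    have hm0 : (0 : ℝ) < m := by positivity
    have h5 := (hT.quantile_spec_nat hF hm).2 (b m + t * η (b m))
      (add_lt_of_neg_right _ (mul_neg_of_neg_of_pos ht0 h3))
    rw [div_lt_iff₀ hm0] at h5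
    simp only [Function.comp, ← mul_div_assoc] at h2
    rw [div_lt_one h4] at h2
    by_contra! hcon
    have hc0 : 0 ≤ c := le_trans (mul_nonneg hm0.le (hT.nonneg _)) hcon
    nlinarith
  · filter_upwards [hle] with m hm using hm.trans_lt hc

theorem tendsto_pow_quantile (hT : IsTailFunction T) (hs : HasSmallValues T) {F : ℝ → ℝ}
    (hF : ∀ x, F x = 1 - T x) {η L : ℝ → ℝ} {D : Set ℝ} (h : HasTailLimit T η D L)
    (hD : D ∈ 𝓝 0) (hL : ContinuousAt L 0) {t : ℝ} (ht : t ∈ D) :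
    Tendsto (fun m : ℕ => F (quantile F (1 - 1 / (m : ℝ)) +
      t * η (quantile F (1 - 1 / (m : ℝ)))) ^ m) atTop (𝓝 (Real.exp (-L t))) := by
  have hb := hT.tendsto_quantile hs hF
  have h1 := (hT.tendsto_mul_quantile hs hF h hD hL).mul ((h.tendsto t ht).comp hb)
  rw [one_mul] at h1
  simp only [hF _, sub_eq_add_neg (1 : ℝ) (T _)]
  refine Real.tendsto_one_add_pow_exp_of_tendsto (h1.neg.congr' ?_)
  filter_upwards [hb.eventually eventually_pos_tailFilter] with m hm
  simp only [Function.comp]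
  field_simp

/-! ### Explicit auxiliary functions in the Fréchet and reversed Weibull cases -/

theorem strictAntiOn_frechet {α : ℝ} (hα : 0 < α) :
    StrictAntiOn (fun t : ℝ => (1 + t) ^ (-α)) (Ioi (-1)) := by
  intro s hs t _ hst
  have hs : -1 < s := hs
  exact Real.rpow_lt_rpow_of_neg (by linarith) (by linarith) (neg_neg_of_pos hα)

theorem continuousOn_frechet {α : ℝ} :
    ContinuousOn (fun t : ℝ => (1 + t) ^ (-α)) (Ioi (-1)) := by
  refine ContinuousOn.rpow_const (by fun_prop) fun t ht => Or.inl ?_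
  have ht : -1 < t := ht
  linarith

theorem strictAntiOn_reversedWeibull {α : ℝ} (hα : 0 < α) :
    StrictAntiOn (fun t : ℝ => (1 - t) ^ α) (Iio 1) := by
  intro s _ t ht hst
  have ht : t < 1 := ht
  exact Real.rpow_lt_rpow (by linarith) (by linarith) hα

theorem continuousOn_reversedWeibull {α : ℝ} (hα : 0 < α) :
    ContinuousOn (fun t : ℝ => (1 - t) ^ α) (Iio 1) :=
  ContinuousOn.rpow_const (by fun_prop) fun _ _ => Or.inr hα.le

/-- Iterating `x ↦ x - η(x) / 2` from `x`, the steps decay at least like a geometric series of sum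
`K η(x)`, while the tail grows geometrically; as the tail is at most `1`, the iteration leaves
`[X, ∞)`, so that `x - X ≤ K η(x)`. -/
theorem sub_le_mul_of_backward (hT : IsTailFunction T) {η : ℝ → ℝ} {X Q K : ℝ} (hQ : 1 < Q)
    (hK : 1 < K) (h : ∀ x, X ≤ x → 0 < T x → 0 < η x ∧ Q * T x ≤ T (x + -(1 / 2) * η x) ∧
      η (x + -(1 / 2) * η x) ≤ (1 - 1 / (2 * K)) * η x) {x : ℝ} (hx : X ≤ x) (hTx : 0 < T x) :
    x - X ≤ K * η x := by
  have key : ∀ k : ℕ, ∀ x, X ≤ x → 0 < T x → 1 < Q ^ k * T x → x - X ≤ K * η x := by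
    intro k
    induction k with
    | zero =>
      intro x _ _ h1
      have := hT.le_one x
      simp only [pow_zero, one_mul] at h1
      linarith
    | succ k ih =>
      intro x hx hTx h1
      obtain ⟨h2, h3, h4⟩ := h x hx hTx
      by_cases hy : X ≤ x + -(1 / 2) * η x
      · have hTy : 0 < T (x + -(1 / 2) * η x) := lt_of_lt_of_le (by positivity) h3
        have h5 := ih _ hy hTy (by
          refine h1.trans_le ?_
          rw [pow_succ, mul_assoc]
          exact mul_le_mul_of_nonneg_left h3 (by positivity))
        have h6 := mul_le_mul_of_nonneg_left h4 (show 0 ≤ K by linarith)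
        have h7 : K * ((1 - 1 / (2 * K)) * η x) = K * η x - 1 / 2 * η x := by
          field_simp
        linarith
      · nlinarith
  obtain ⟨k, hk⟩ := pow_unbounded_of_one_lt (1 / T x) hQ
  rw [div_lt_iff₀ hTx] at hk
  exact key k x hx hTx hk

theorem pos_of_frechet (hT : IsTailFunction T) (hs : HasSmallValues T) {α : ℝ} (hα : 0 < α)
    {η : ℝ → ℝ} (h : HasTailLimit T η (Ioi (-1)) fun t => (1 + t) ^ (-α)) (x : ℝ) : 0 < T x := by
  have h1 : (1 : ℝ) ∈ Ioi (-1) := by simp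
  have h2 := hT.tendsto_aux_shift isOpen_Ioi h (strictAntiOn_frechet hα) h1 h1
    (v := 3) (by simp; norm_num) (by positivity) one_ne_zero (by
      rw [← Real.mul_rpow (by norm_num) (by norm_num)]; norm_num)
  have h3 := h.tendsto_shift h1 (by positivity)
  obtain ⟨X, hX, hall⟩ := (hT.eventually_tailFilter hs).1
    ((h2.eventually (lt_mem_nhds (show (1 : ℝ) < (3 - 1) / 1 by norm_num))).and
      ((h3.eventually eventually_pos_tailFilter).and h.pos))
  -- the steps of the iteration `x ↦ x + η(x)` do not decrease, and the tail stays positive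
  have key : ∀ k : ℕ, ∀ x, X ≤ x → 0 < T x → 0 < T (x + k * η x) := by
    intro k
    induction k with
    | zero => intro x _ hTx; simpa using hTx
    | succ k ih =>
      intro x hx hTx
      obtain ⟨h4, h5, h6⟩ := hall x hx hTx
      rw [lt_div_iff₀ h6] at h4
      refine (ih _ (by linarith) h5).trans_le (hT.antitone ?_)
      have := mul_le_mul_of_nonneg_left h4.le (Nat.cast_nonneg (α := ℝ) k)
      push_cast
      linarith
  have hη := (hall X le_rfl hX).2.2
  obtain ⟨k, hk⟩ := exists_nat_ge ((x - X) / η X)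
  rw [div_le_iff₀ hη] at hk
  exact (key k X le_rfl hX).trans_le (hT.antitone (by linarith))

/-- In the Fréchet case the tail is regularly varying: the identity is an auxiliary function. -/
theorem hasTailLimit_id (hT : IsTailFunction T) (hs : HasSmallValues T) {α : ℝ} (hα : 0 < α)
    {η : ℝ → ℝ} (h : HasTailLimit T η (Ioi (-1)) fun t => (1 + t) ^ (-α)) :
    HasTailLimit T id (Ioi (-1)) fun t => (1 + t) ^ (-α) := by
  have hgt : ∀ X : ℝ, ∀ᶠ x in tailFilter T, X < x := fun X =>
    hT.eventually_gt_tailFilter (hT.pos_of_frechet hs hα h X)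
  refine hT.hasTailLimit_congr isOpen_Ioi h continuousOn_frechet (hgt 0) ?_
  refine tendsto_order.2 ⟨fun c hc => ?_, fun c hc => ?_⟩
  · -- `x - d η(x)` tends to the end point for `d < 1`, so it is nonnegative
    obtain ⟨d, hcd, hd⟩ := exists_between hc
    have hd1 : -d ∈ Ioi (-1 : ℝ) := by simpa using hd
    filter_upwards [(h.tendsto_shift hd1 (Real.rpow_pos_of_pos (by linarith) _)).eventually
      hT.eventually_nonneg_tailFilter, h.pos] with x hx hη
    simp only [id]
    refine hcd.trans_le ((le_div_iff₀ hη).2 (by linarith))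
  · have hK : 1 < (1 + c) / 2 := by linarith
    have hhalf : -(1 / 2) ∈ Ioi (-1 : ℝ) := by simp; norm_num
    have hpos : (0 : ℝ) < (1 + -(1 / 2)) ^ (-α) := Real.rpow_pos_of_pos (by norm_num) _
    have hr := hT.tendsto_aux_shift isOpen_Ioi h (strictAntiOn_frechet hα) hhalf
      (u := 1) (by simp) (v := 0) (by simp) hpos one_ne_zero (by
        rw [← Real.mul_rpow (by norm_num) (by norm_num)]; norm_num)
    have hQ1 : (1 : ℝ) < (1 + -(1 / 2)) ^ (-α) :=
      Real.one_lt_rpow_of_pos_of_lt_one_of_neg (by norm_num) (by norm_num) (neg_neg_of_pos hα)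
    obtain ⟨Q, hQ, hQ'⟩ := exists_between hQ1
    have hθ : (0 - -(1 / 2)) / 1 < 1 - 1 / (2 * ((1 + c) / 2)) := by
      have : 1 / (2 * ((1 + c) / 2)) < 1 / 2 := by
        apply one_div_lt_one_div_of_lt <;> linarith
      linarith
    obtain ⟨X, hX, hall⟩ := (hT.eventually_tailFilter hs).1
      (h.pos.and (((h.tendsto _ hhalf).eventually (lt_mem_nhds hQ')).and
        (hr.eventually (gt_mem_nhds hθ))))
    have hmain := fun x => hT.sub_le_mul_of_backward (η := η) (X := X) (x := x) hQ hK
      fun x hx hTx => by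
        obtain ⟨h1, h2, h3⟩ := hall x hx hTx
        rw [lt_div_iff₀ hTx] at h2
        rw [div_lt_iff₀ h1] at h3
        exact ⟨h1, h2.le, h3.le⟩
    filter_upwards [h.pos, hgt X, eventually_pos_tailFilter, hgt 0, hgt (4 * c * X / (c - 1))]
      with x h1 h2 h3 h4 h5
    have h6 := hmain x h2.le h3
    rw [div_lt_iff₀ (by linarith)] at h5
    rw [id, div_lt_iff₀ h1]
    nlinarith

/-- Iterating `x ↦ x + η(x) / 2` from `x`, the steps decay at least like a geometric series of sum
`K η(x)`, while the tail tends to `0`; so the end point is at most `x + K η(x)`. -/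
theorem eq_zero_of_forward (hT : IsTailFunction T) {η : ℝ → ℝ} {X q K : ℝ} (hq0 : 0 ≤ q)
    (hq : q < 1) (hK : 1 < K) (h : ∀ x, X ≤ x → 0 < T x → 0 < η x ∧
      T (x + 1 / 2 * η x) ≤ q * T x ∧ η (x + 1 / 2 * η x) ≤ (1 - 1 / (2 * K)) * η x)
    {x : ℝ} (hx : X ≤ x) (hTx : 0 < T x) : T (x + K * η x) = 0 := by
  have key : ∀ k : ℕ, ∀ x, X ≤ x → 0 < T x → T (x + K * η x) ≤ q ^ k * T x := by
    intro k
    induction k with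
    | zero =>
      intro x hx hTx
      have := mul_pos (show 0 < K by linarith) (h x hx hTx).1
      simpa using hT.antitone (show x ≤ x + K * η x by linarith)
    | succ k ih =>
      intro x hx hTx
      obtain ⟨h2, h3, h4⟩ := h x hx hTx
      have h6 := mul_le_mul_of_nonneg_left h4 (show 0 ≤ K by linarith)
      have h7 : K * ((1 - 1 / (2 * K)) * η x) = K * η x - 1 / 2 * η x := by
        field_simp
      rcases (hT.nonneg (x + 1 / 2 * η x)).eq_or_lt with h0 | hTy
      · have h8 : T (x + K * η x) ≤ 0 := by
          rw [h0]
          exact hT.antitone (by nlinarith)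
        exact h8.trans (mul_nonneg (pow_nonneg hq0 _) hTx.le)
      · calc T (x + K * η x)
            ≤ T (x + 1 / 2 * η x + K * η (x + 1 / 2 * η x)) := hT.antitone (by linarith)
          _ ≤ q ^ k * T (x + 1 / 2 * η x) := ih _ (by linarith) hTy
          _ ≤ q ^ k * (q * T x) := mul_le_mul_of_nonneg_left h3 (pow_nonneg hq0 _)
          _ = q ^ (k + 1) * T x := by ring
  have hlim : Tendsto (fun k : ℕ => q ^ k * T x) atTop (𝓝 0) := by
    simpa using (tendsto_pow_atTop_nhds_zero_of_lt_one hq0 hq).mul_const (T x)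
  exact le_antisymm (ge_of_tendsto' hlim fun k => key k x hx hTx) (hT.nonneg _)

/-- In the reversed Weibull case the end point `xF` is finite, and `x ↦ xF - x` is an auxiliary
function. -/
theorem exists_endpoint_of_reversedWeibull (hT : IsTailFunction T) (hs : HasSmallValues T) {α : ℝ}
    (hα : 0 < α) {η : ℝ → ℝ} (h : HasTailLimit T η (Iio 1) fun t => (1 - t) ^ α) :
    ∃ xF, (∀ x, 0 < T x ↔ x < xF) ∧ HasTailLimit T (fun x => xF - x) (Iio 1)
      fun t => (1 - t) ^ α := by
  have hhalf : (1 / 2 : ℝ) ∈ Iio (1 : ℝ) := by simp; norm_num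
  have hpos : (0 : ℝ) < (1 - 1 / 2) ^ α := Real.rpow_pos_of_pos (by norm_num) _
  have hr := hT.tendsto_aux_shift isOpen_Iio h (strictAntiOn_reversedWeibull hα) hhalf hhalf
    (v := 3 / 4) (by simp; norm_num) hpos (by norm_num) (by
      rw [← Real.mul_rpow (by norm_num) (by norm_num)]; norm_num)
  have hq1 : (1 - 1 / 2 : ℝ) ^ α < 1 := Real.rpow_lt_one (by norm_num) (by norm_num) hα
  obtain ⟨q, hq, hq'⟩ := exists_between hq1
  have hzero : ∀ K : ℝ, 1 < K → ∀ᶠ x in tailFilter T, T (x + K * η x) = 0 := by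
    intro K hK
    have hθ : ((3 / 4 - 1 / 2) / (1 / 2) : ℝ) < 1 - 1 / (2 * K) := by
      have : 1 / (2 * K) < 1 / 2 := by
        apply one_div_lt_one_div_of_lt <;> linarith
      linarith
    obtain ⟨X, hX, hall⟩ := (hT.eventually_tailFilter hs).1
      (h.pos.and (((h.tendsto _ hhalf).eventually (gt_mem_nhds hq)).and
        (hr.eventually (gt_mem_nhds hθ))))
    refine (hT.eventually_tailFilter hs).2 ⟨X, hX, fun x hx hTx =>
      hT.eq_zero_of_forward (hpos.le.trans hq.le) hq' hK (fun x hx hTx => ?_) hx hTx⟩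
    obtain ⟨h1, h2, h3⟩ := hall x hx hTx
    rw [div_lt_iff₀ hTx] at h2
    rw [div_lt_iff₀ h1] at h3
    exact ⟨h1, h2.le, h3.le⟩
  have := hT.neBot_tailFilter hs
  obtain ⟨x₀, hx₀⟩ := (hzero 2 one_lt_two).exists
  have hbdd : BddBelow {x | T x = 0} := ⟨0, fun x hx => by
    by_contra! hneg
    rw [mem_ofPred_eq, hT.eq_one_of_neg x hneg] at hx
    exact one_ne_zero hx⟩
  have hiff : ∀ x, 0 < T x ↔ x < sInf {x | T x = 0} := by
    intro x
    constructor
    · intro hx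
      obtain ⟨y, hxy, hy⟩ := hT.exists_gt_pos hx
      refine hxy.trans_le (le_csInf ⟨_, hx₀⟩ fun z hz => ?_)
      by_contra! hlt
      have hz : T z = 0 := hz
      have := hT.antitone hlt.le
      linarith
    · intro hx
      exact (hT.nonneg x).lt_of_ne' fun h0 => absurd (csInf_le hbdd h0) (not_le.2 hx)
  refine ⟨sInf {x | T x = 0}, hiff, ?_⟩
  set xF := sInf {x | T x = 0}
  refine hT.hasTailLimit_congr isOpen_Iio h (continuousOn_reversedWeibull hα) ?_ ?_
  · filter_upwards [eventually_pos_tailFilter] with x hx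
    exact sub_pos.2 ((hiff x).1 hx)
  · refine tendsto_order.2 ⟨fun c hc => ?_, fun c hc => ?_⟩
    · obtain ⟨d, hcd, hd⟩ := exists_between hc
      filter_upwards [(h.tendsto_shift (t := d) hd
        (Real.rpow_pos_of_pos (by linarith) _)).eventually eventually_pos_tailFilter, h.pos]
        with x hx hη
      have := (hiff _).1 hx
      exact hcd.trans_le ((le_div_iff₀ hη).2 (by linarith))
    · obtain ⟨K, hK, hKc⟩ := exists_between hc
      filter_upwards [hzero K hK, h.pos] with x hx hη
      refine lt_of_le_of_lt ((div_le_iff₀ hη).2 ?_) hKc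
      by_contra! hlt
      have := (hiff (x + K * η x)).2 (by linarith)
      linarith

/-! ### Polynomial bounds on the tail -/

/-- Iterating `x ↦ x + η(x)`, where a step multiplies `η` by at most `ρ` and `T` by at most
`ρ ^ (-β)`, gives a polynomial upper bound on the tail to the right of `x`. -/
theorem eventually_tail_le (hT : IsTailFunction T) (hs : HasSmallValues T) {η : ℝ → ℝ} {ρ β : ℝ}
    (hρ : 1 < ρ) (hβ : 0 < β) (h : ∀ᶠ x in tailFilter T, 0 < η x ∧
      T (x + η x) ≤ ρ ^ (-β) * T x ∧ η (x + η x) ≤ ρ * η x) :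
    ∃ C > 0, ∀ᶠ x in tailFilter T, 0 < η x ∧ ∀ t > 0, T (x + t * η x) ≤ C * t ^ (-β) * T x := by
  have hρ0 : 0 < ρ := by linarith
  have hρ1 : 0 < ρ - 1 := by linarith
  obtain ⟨X, hX, hall⟩ := (hT.eventually_tailFilter hs).1 h
  have key : ∀ k : ℕ, ∀ x, X ≤ x → 0 < T x →
      T (x + (ρ ^ k - 1) / (ρ - 1) * η x) ≤ (ρ ^ (-β)) ^ k * T x := by
    intro k
    induction k with
    | zero => intro x _ _; simp
    | succ k ih =>
      intro x hx hTx
      obtain ⟨h1, h2, h3⟩ := hall x hx hTx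
      have hk : 0 ≤ (ρ ^ k - 1) / (ρ - 1) :=
        div_nonneg (sub_nonneg.2 (one_le_pow₀ hρ.le)) hρ1.le
      have hstep : (ρ ^ (k + 1) - 1) / (ρ - 1) = 1 + ρ * ((ρ ^ k - 1) / (ρ - 1)) := by
        field_simp
        ring
      rw [hstep]
      rcases (hT.nonneg (x + η x)).eq_or_lt with h0 | hTy
      · have h8 : T (x + (1 + ρ * ((ρ ^ k - 1) / (ρ - 1))) * η x) ≤ 0 := by
          rw [h0]
          refine hT.antitone ?_
          have : 0 ≤ ρ * ((ρ ^ k - 1) / (ρ - 1)) * η x := by positivity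
          linarith
        exact h8.trans (by positivity)
      · calc T (x + (1 + ρ * ((ρ ^ k - 1) / (ρ - 1))) * η x)
            ≤ T (x + η x + (ρ ^ k - 1) / (ρ - 1) * η (x + η x)) := hT.antitone (by
              have := mul_le_mul_of_nonneg_left h3 hk
              linarith)
          _ ≤ (ρ ^ (-β)) ^ k * T (x + η x) := ih _ (by linarith) hTy
          _ ≤ (ρ ^ (-β)) ^ k * (ρ ^ (-β) * T x) := by gcongr
          _ = (ρ ^ (-β)) ^ (k + 1) * T x := by ring
  refine ⟨((ρ - 1) / ρ) ^ (-β), by positivity,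
    (hT.eventually_tailFilter hs).2 ⟨X, hX, fun x hx hTx => ⟨(hall x hx hTx).1, fun t ht => ?_⟩⟩⟩
  have hη := (hall x hx hTx).1
  obtain ⟨k, hk1, hk2⟩ := exists_nat_pow_near (x := 1 + (ρ - 1) * t)
    (by have := mul_pos hρ1 ht; linarith) hρ
  have hle : (ρ ^ k - 1) / (ρ - 1) ≤ t := by
    rw [div_le_iff₀ hρ1]
    linarith
  have hlow : (ρ - 1) / ρ * t ≤ ρ ^ k := by
    rw [div_mul_eq_mul_div, div_le_iff₀ hρ0, ← pow_succ]
    linarith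
  calc T (x + t * η x) ≤ T (x + (ρ ^ k - 1) / (ρ - 1) * η x) := hT.antitone (by gcongr)
    _ ≤ (ρ ^ (-β)) ^ k * T x := key k x hx hTx
    _ = (ρ ^ k) ^ (-β) * T x := by
      rw [← Real.rpow_natCast, ← Real.rpow_mul hρ0.le, ← Real.rpow_natCast, ← Real.rpow_mul hρ0.le,
        mul_comm (-β)]
    _ ≤ ((ρ - 1) / ρ * t) ^ (-β) * T x := mul_le_mul_of_nonneg_right
        (Real.rpow_le_rpow_of_nonpos (by positivity) hlow (neg_nonpos.2 hβ.le)) hTx.le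
    _ = ((ρ - 1) / ρ) ^ (-β) * t ^ (-β) * T x := by
      rw [Real.mul_rpow (by positivity) ht.le]

/-- Iterating `x ↦ x - η(x)`, where a step multiplies `η` by at most `ρ` and `T` by at least
`ρ ^ β`, gives a polynomial lower bound on the tail between `0` and `x`. -/
theorem eventually_le_tail (hT : IsTailFunction T) (hs : HasSmallValues T) {η : ℝ → ℝ} {ρ β : ℝ}
    (hρ : 1 < ρ) (hβ : 0 < β) (h : ∀ᶠ x in tailFilter T, 0 < η x ∧
      ρ ^ β * T x ≤ T (x - η x) ∧ η (x - η x) ≤ ρ * η x) :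
    ∃ c > 0, ∀ᶠ x in tailFilter T, ∀ s > 0, 0 ≤ x - s * η x →
      c * s ^ β * T x ≤ T (x - s * η x) := by
  have hρ0 : 0 < ρ := by linarith
  have hρ1 : 0 < ρ - 1 := by linarith
  obtain ⟨X, hX, hall⟩ : ∃ X, 0 < T X ∧ ∀ x, X ≤ x → 0 < T x → 0 ≤ X ∧ 0 < η x ∧
      ρ ^ β * T x ≤ T (x - η x) ∧ η (x - η x) ≤ ρ * η x := by
    obtain ⟨X, hX, hall⟩ := (hT.eventually_tailFilter hs).1 h
    obtain ⟨z, hz0, hz1⟩ := hs 1 one_pos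
    have hz : 0 ≤ z := by
      by_contra! hneg
      rw [hT.eq_one_of_neg z hneg] at hz1
      exact lt_irrefl _ hz1
    refine ⟨max X z, ?_, fun x hx hTx => ⟨hz.trans (le_max_right _ _),
      hall x ((le_max_left _ _).trans hx) hTx⟩⟩
    rcases max_choice X z with h | h <;> rw [h] <;> assumption
  have hX0 : 0 ≤ X := (hall X le_rfl hX).1
  have key : ∀ k : ℕ, ∀ x, X ≤ x → 0 < T x → X ≤ x - (ρ ^ k - 1) / (ρ - 1) * η x →
      (ρ ^ β) ^ k * T x ≤ T (x - (ρ ^ k - 1) / (ρ - 1) * η x) := by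
    intro k
    induction k with
    | zero => intro x _ _; simp
    | succ k ih =>
      intro x hx hTx hxk
      obtain ⟨-, h1, h2, h3⟩ := hall x hx hTx
      have hk : 0 ≤ (ρ ^ k - 1) / (ρ - 1) :=
        div_nonneg (sub_nonneg.2 (one_le_pow₀ hρ.le)) hρ1.le
      have hstep : (ρ ^ (k + 1) - 1) / (ρ - 1) = 1 + ρ * ((ρ ^ k - 1) / (ρ - 1)) := by
        field_simp
        ring
      rw [hstep] at hxk ⊢
      have h4 := mul_le_mul_of_nonneg_left h3 hk
      have h5 : 0 ≤ ρ * ((ρ ^ k - 1) / (ρ - 1)) * η x := by positivity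
      have hTy : 0 < T (x - η x) := lt_of_lt_of_le (by positivity) h2
      calc (ρ ^ β) ^ (k + 1) * T x = (ρ ^ β) ^ k * (ρ ^ β * T x) := by ring
        _ ≤ (ρ ^ β) ^ k * T (x - η x) := by gcongr
        _ ≤ T (x - η x - (ρ ^ k - 1) / (ρ - 1) * η (x - η x)) :=
          ih _ (by linarith) hTy (by linarith)
        _ ≤ T (x - (1 + ρ * ((ρ ^ k - 1) / (ρ - 1))) * η x) := hT.antitone (by linarith)
  have hnear : ∀ x, X ≤ x → 0 < T x → ∀ s > 0, X ≤ x - s * η x →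
      ((ρ - 1) / ρ * s) ^ β * T x ≤ T (x - s * η x) := by
    intro x hx hTx s hs0 hxs
    obtain ⟨-, hη, -, -⟩ := hall x hx hTx
    obtain ⟨k, hk1, hk2⟩ := exists_nat_pow_near (x := 1 + (ρ - 1) * s)
      (by have := mul_pos hρ1 hs0; linarith) hρ
    have hle : (ρ ^ k - 1) / (ρ - 1) ≤ s := by
      rw [div_le_iff₀ hρ1]
      linarith
    have hlow : (ρ - 1) / ρ * s ≤ ρ ^ k := by
      rw [div_mul_eq_mul_div, div_le_iff₀ hρ0, ← pow_succ]
      linarith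
    have hle' := mul_le_mul_of_nonneg_right hle hη.le
    calc ((ρ - 1) / ρ * s) ^ β * T x ≤ (ρ ^ k) ^ β * T x := by gcongr
      _ = (ρ ^ β) ^ k * T x := by
        rw [← Real.rpow_natCast (ρ ^ β), ← Real.rpow_mul hρ0.le, ← Real.rpow_natCast,
          ← Real.rpow_mul hρ0.le, mul_comm β]
      _ ≤ T (x - (ρ ^ k - 1) / (ρ - 1) * η x) := key k x hx hTx (by linarith)
      _ ≤ T (x - s * η x) := hT.antitone (by linarith)
  -- below `X` the bound at `X` is used; this costs the factor `θ ^ β`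
  obtain ⟨X₁, hX₁, hTX₁⟩ := hT.exists_gt_pos hX
  have hX₁0 : 0 < X₁ := hX0.trans_lt hX₁
  set θ : ℝ := (X₁ - X) / X₁ with hθ
  have hθ0 : 0 < θ := div_pos (sub_pos.2 hX₁) hX₁0
  have hθ1 : θ ≤ 1 := by
    rw [hθ, div_le_one hX₁0]
    linarith
  refine ⟨((ρ - 1) / ρ * θ) ^ β, by positivity,
    (hT.eventually_tailFilter hs).2 ⟨X₁, hTX₁, fun x hx hTx s hs0 hxs => ?_⟩⟩
  have hXx : X ≤ x := hX₁.le.trans hx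
  obtain ⟨-, hη, -, -⟩ := hall x hXx hTx
  rw [← Real.mul_rpow (by positivity) hs0.le]
  by_cases hc : X ≤ x - s * η x
  · refine le_trans ?_ (hnear x hXx hTx s hs0 hc)
    have : (ρ - 1) / ρ * θ * s ≤ (ρ - 1) / ρ * s := by
      have h1 : 0 ≤ (ρ - 1) / ρ * s := by positivity
      nlinarith
    gcongr
  · have hs' : θ * s ≤ (x - X) / η x := by
      rw [le_div_iff₀ hη]
      have h1 : θ * s * η x ≤ θ * x := by
        rw [mul_assoc]
        exact mul_le_mul_of_nonneg_left (by linarith) hθ0.le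
      refine h1.trans ?_
      rw [hθ, div_mul_eq_mul_div, div_le_iff₀ hX₁0]
      nlinarith
    have hX' : x - (x - X) / η x * η x = X := by
      rw [div_mul_cancel₀ _ hη.ne']
      ring
    have h1 := hnear x hXx hTx _ (lt_of_lt_of_le (by positivity) hs') hX'.ge
    rw [hX'] at h1
    refine le_trans ?_ (h1.trans (hT.antitone (not_le.1 hc).le))
    rw [mul_assoc ((ρ - 1) / ρ)]
    gcongr

end IsTailFunction

/-! ### Expectations in terms of distribution functions -/

section LayerCake

variable {Ω : Type*} [MeasurableSpace Ω] {μ : Measure Ω} [IsProbabilityMeasure μ] {Z : Ω → ℝ}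
  {H : ℝ → ℝ}

theorem measureReal_lt_of_cdf (hZ : Measurable Z) (hH : ∀ y, μ.real {ω | Z ω ≤ y} = H y) (t : ℝ) :
    μ.real {ω | t < Z ω} = 1 - H t := by
  have : {ω | t < Z ω} = {ω | Z ω ≤ t}ᶜ := by ext; simp
  rw [this, probReal_compl_eq_one_sub (measurableSet_le hZ measurable_const), hH]

theorem lintegral_ofReal_eq_of_cdf (hZ : Measurable Z)
    (hH : ∀ y, μ.real {ω | Z ω ≤ y} = H y) :
    ∫⁻ ω, ENNReal.ofReal (Z ω) ∂μ = ∫⁻ t in Ioi (0 : ℝ), ENNReal.ofReal (1 - H t) := by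
  have h1 := lintegral_eq_lintegral_meas_lt μ (f := fun ω => max (Z ω) 0)
    (Eventually.of_forall fun ω => le_max_right _ _) (hZ.max measurable_const).aemeasurable
  have h2 : ∀ ω, ENNReal.ofReal (max (Z ω) 0) = ENNReal.ofReal (Z ω) := fun ω => by
    rcases le_total (Z ω) 0 with h | h
    · simp [h, ENNReal.ofReal_of_nonpos]
    · simp [h]
  simp only [h2] at h1
  rw [h1]
  refine setLIntegral_congr_fun measurableSet_Ioi fun t ht => ?_
  have ht : 0 < t := ht
  have h3 : {ω | t < max (Z ω) 0} = {ω | t < Z ω} := by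
    ext ω
    simp [not_lt.2 ht.le]
  simp only [h3]
  rw [← measureReal_lt_of_cdf hZ hH t, ofReal_measureReal]

theorem integral_eq_of_cdf (hZ : Measurable Z) (hint : Integrable Z μ)
    (hH : ∀ y, μ.real {ω | Z ω ≤ y} = H y) :
    ∫ ω, Z ω ∂μ = (∫ t in Ioi (0 : ℝ), (1 - H t)) - ∫ t in Ioi (0 : ℝ), H (-t) := by
  have h1 : ∫ ω, Z ω ∂μ = ∫ ω, max (Z ω) 0 ∂μ - ∫ ω, max (-Z ω) 0 ∂μ := by
    rw [← integral_sub hint.pos_part hint.neg_part]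
    refine integral_congr_ae (Eventually.of_forall fun ω => ?_)
    rcases le_total (Z ω) 0 with h | h <;> simp [h]
  rw [h1,
    hint.pos_part.integral_eq_integral_meas_lt (Eventually.of_forall fun ω => le_max_right _ _),
    hint.neg_part.integral_eq_integral_meas_le (Eventually.of_forall fun ω => le_max_right _ _)]
  congr 1
  · refine setIntegral_congr_fun measurableSet_Ioi fun t ht => ?_
    have ht : 0 < t := ht
    have h3 : {ω | t < max (Z ω) 0} = {ω | t < Z ω} := by
      ext ω
      simp [not_lt.2 ht.le]
    simp only [h3]
    exact measureReal_lt_of_cdf hZ hH t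
  · refine setIntegral_congr_fun measurableSet_Ioi fun t ht => ?_
    have ht : 0 < t := ht
    have h3 : {ω | t ≤ max (-Z ω) 0} = {ω | Z ω ≤ -t} := by
      ext ω
      simp only [le_max_iff, mem_ofPred_eq, not_le.2 ht, or_false]
      constructor <;> intro h <;> linarith
    simp only [h3]
    exact hH _

end LayerCake

/-! ### Maxima of samples -/

section SampleMax

variable {Ω : Type*} [MeasurableSpace Ω] {μ : Measure Ω} {F : ℝ → ℝ} {m : ℕ} {Y : Fin m → Ω → ℝ}

theorem IsIIDSample.measurable_sampleMax (hY : IsIIDSample μ F Y) : Measurable (sampleMax Y) :=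
  Measurable.iSup hY.measurable

theorem IsIIDSample.measureReal_sampleMax_le [IsProbabilityMeasure μ] (hY : IsIIDSample μ F Y)
    (hm : m ≠ 0) (y : ℝ) : μ.real {ω | sampleMax Y ω ≤ y} = F y ^ m := by
  have : Nonempty (Fin m) := ⟨⟨0, by omega⟩⟩
  have h1 : {ω | sampleMax Y ω ≤ y} = ⋂ i, Y i ⁻¹' Iic y := by
    ext ω
    simp [sampleMax, ciSup_le_iff (Set.finite_range fun i => Y i ω).bddAbove]
  rw [h1, measureReal_def, hY.indep.meas_iInter fun i => ⟨_, measurableSet_Iic, rfl⟩,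
    ENNReal.toReal_prod]
  have h2 : ∀ i, (μ (Y i ⁻¹' Iic y)).toReal = F y := fun i => by
    have := Measure.isProbabilityMeasure_map (μ := μ) (hY.measurable i).aemeasurable
    rw [← hY.cdf_eq i y, cdf_eq_real, measureReal_def,
      Measure.map_apply (hY.measurable i) measurableSet_Iic]
  simp [h2]

theorem IsIIDSample.sampleMax_nonneg [IsProbabilityMeasure μ] (hY : IsIIDSample μ F Y)
    {T : ℝ → ℝ} (hT : IsTailFunction T) (hF : ∀ x, F x = 1 - T x) : 0 ≤ᵐ[μ] sampleMax Y := by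
  rcases eq_or_ne m 0 with rfl | hm
  · exact Eventually.of_forall fun ω => by simp [sampleMax]
  have hcdf := hY.measureReal_sampleMax_le hm
  have h1 : ∀ k : ℕ, ∀ᵐ ω ∂μ, ¬ sampleMax Y ω ≤ -(1 / ((k : ℝ) + 1)) := fun k => by
    have h2 := hcdf (-(1 / ((k : ℝ) + 1)))
    rw [hF, hT.eq_one_of_neg _ (neg_neg_of_pos (by positivity)), sub_self, zero_pow hm,
      measureReal_eq_zero_iff] at h2
    exact measure_eq_zero_iff_ae_notMem.1 h2
  filter_upwards [ae_all_iff.2 h1] with ω hω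
  by_contra! hneg
  obtain ⟨k, hk⟩ := exists_nat_one_div_lt (neg_pos.2 hneg)
  exact hω k (by linarith)

/-- The maxima of samples are integrable if the tail is. -/
theorem IsIIDSample.integrable_sampleMax [IsProbabilityMeasure μ] (hY : IsIIDSample μ F Y)
    {T : ℝ → ℝ} (hT : IsTailFunction T) (hF : ∀ x, F x = 1 - T x)
    (hint : IntegrableOn T (Ioi 0)) : Integrable (sampleMax Y) μ := by
  rcases eq_or_ne m 0 with rfl | hm
  · have : sampleMax Y = fun _ => 0 := by
      ext ω
      simp [sampleMax]
    rw [this]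
    exact integrable_const 0
  have hmeas := hY.measurable_sampleMax
  have hcdf := hY.measureReal_sampleMax_le hm
  have hnn := hY.sampleMax_nonneg hT hF
  refine ⟨hmeas.aestronglyMeasurable, ?_⟩
  rw [hasFiniteIntegral_iff_ofReal hnn, lintegral_ofReal_eq_of_cdf hmeas hcdf]
  calc ∫⁻ t in Ioi (0 : ℝ), ENNReal.ofReal (1 - F t ^ m)
      ≤ ∫⁻ t in Ioi (0 : ℝ), ENNReal.ofReal (m * T t) := by
        refine lintegral_mono fun t => ENNReal.ofReal_le_ofReal ?_
        have := one_add_mul_le_pow (a := -T t) (by linarith [hT.le_one t]) m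
        rw [hF, sub_eq_add_neg 1 (T t)]
        linarith
    _ < ⊤ := (hasFiniteIntegral_iff_ofReal (Eventually.of_forall fun t =>
        mul_nonneg (Nat.cast_nonneg m) (hT.nonneg t))).1 (hint.const_mul (m : ℝ)).2

end SampleMax

/-! ### Convergence of expectations by domination -/

namespace IsTailFunction

variable {T : ℝ → ℝ}

theorem integrableOn_of_bound (hT : IsTailFunction T) {x h C β : ℝ} (hh : 0 < h) (hβ : 1 < β)
    (hC : ∀ t > 0, T (x + t * h) ≤ C * t ^ (-β) * T x) : IntegrableOn T (Ioi 0) := by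
  have hA : (0 : ℝ) < 2 * |x| + 1 := by positivity
  rw [← Ioc_union_Ioi_eq_Ioi hA.le]
  refine IntegrableOn.union ?_ ?_
  · exact (hT.antitone.antitoneOn _).integrableOn_isCompact isCompact_Icc |>.mono_set
      Ioc_subset_Icc_self
  · have hdom : IntegrableOn (fun y : ℝ => |C| * (1 / (2 * h)) ^ (-β) * T x * y ^ (-β))
        (Ioi (2 * |x| + 1)) :=
      (integrableOn_Ioi_rpow_of_lt (by linarith) hA).const_mul _
    refine Integrable.mono' hdom hT.antitone.measurable.aestronglyMeasurable ?_
    filter_upwards [ae_restrict_mem measurableSet_Ioi] with y hy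
    have hy : 2 * |x| + 1 < y := hy
    have hy0 : 0 < y := hA.trans hy
    have h1 : y / 2 ≤ y - x := by linarith [le_abs_self x]
    have ht : 1 / (2 * h) * y ≤ (y - x) / h := by
      rw [le_div_iff₀ hh]
      field_simp
      linarith
    have ht0 : 0 < (y - x) / h := lt_of_lt_of_le (by positivity) ht
    have h2 := hC _ ht0
    rw [div_mul_cancel₀ _ hh.ne', add_sub_cancel] at h2
    have h0 := hT.nonneg x
    rw [Real.norm_of_nonneg (hT.nonneg y)]
    calc T y ≤ C * ((y - x) / h) ^ (-β) * T x := h2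
      _ ≤ |C| * (1 / (2 * h) * y) ^ (-β) * T x := by
        refine mul_le_mul_of_nonneg_right (mul_le_mul (le_abs_self C) ?_ (by positivity)
          (abs_nonneg C)) h0
        exact Real.rpow_le_rpow_of_nonpos (by positivity) ht (by linarith)
      _ = |C| * (1 / (2 * h)) ^ (-β) * T x * y ^ (-β) := by
        rw [Real.mul_rpow (by positivity) hy0.le]
        ring

/-- The integrals that express `(E M - b) / a` for the maximum `M` of a sample of size `m`, with
`b` the quantile at `1 - 1 / m` and `a = η(b)`, converge to those for the limit law. The bounds on
the tail provide the dominating functions; below `0`, where there is no bound, the distribution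
function vanishes. -/
theorem tendsto_integral_sub_integral (hT : IsTailFunction T) (hs : HasSmallValues T) {F : ℝ → ℝ}
    (hF : ∀ x, F x = 1 - T x) {η G : ℝ → ℝ} {C β c γ : ℝ} (hβ : 1 < β) (hc : 0 < c) (hγ : 0 < γ)
    (hright : ∀ᶠ x in tailFilter T, 0 < η x ∧ ∀ t > 0, T (x + t * η x) ≤ C * t ^ (-β) * T x)
    (hleft : ∀ᶠ x in tailFilter T, ∀ s > 0, 0 ≤ x - s * η x →
      c * s ^ γ * T x ≤ T (x - s * η x))
    (h1 : Tendsto (fun m : ℕ => (m : ℝ) * T (quantile F (1 - 1 / (m : ℝ)))) atTop (𝓝 1))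
    (hlim : ∀ t, |t| ≠ 1 → Tendsto (fun m : ℕ => F (quantile F (1 - 1 / (m : ℝ)) +
      t * η (quantile F (1 - 1 / (m : ℝ)))) ^ m) atTop (𝓝 (G t))) :
    Tendsto (fun m : ℕ =>
      (∫ t in Ioi (0 : ℝ), (1 - F (quantile F (1 - 1 / (m : ℝ)) +
        t * η (quantile F (1 - 1 / (m : ℝ)))) ^ m)) -
      ∫ t in Ioi (0 : ℝ), F (quantile F (1 - 1 / (m : ℝ)) +
        -t * η (quantile F (1 - 1 / (m : ℝ)))) ^ m) atTop
      (𝓝 ((∫ t in Ioi (0 : ℝ), (1 - G t)) - ∫ t in Ioi (0 : ℝ), G (-t))) := by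
  have hb := hT.tendsto_quantile hs hF
  have hspec := fun m hm => (hT.quantile_spec_nat hF (m := m) hm).1
  set b : ℕ → ℝ := fun m => quantile F (1 - 1 / (m : ℝ)) with hbdef
  have hFm : Measurable F := by
    have : F = fun x => 1 - T x := funext hF
    rw [this]
    exact measurable_const.sub hT.antitone.measurable
  have hF0 : ∀ x, 0 ≤ F x := fun x => by rw [hF]; linarith [hT.le_one x]
  have hF1 : ∀ x, F x ≤ 1 := fun x => by rw [hF]; linarith [hT.nonneg x]
  have hne : ∀ᵐ t ∂(volume.restrict (Ioi (0 : ℝ))), 0 < t ∧ |t| ≠ 1 := by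
    have h2 : ∀ᵐ t ∂(volume.restrict (Ioi (0 : ℝ))), t ≠ 1 :=
      ae_restrict_of_ae (Measure.ae_ne volume 1)
    filter_upwards [ae_restrict_mem measurableSet_Ioi, h2] with t ht ht1
    have ht : 0 < t := ht
    exact ⟨ht, by rwa [abs_of_pos ht]⟩
  refine Tendsto.sub ?_ ?_
  · refine tendsto_integral_filter_of_dominated_convergence (fun t => min 1 (|C| * t ^ (-β)))
      (Eventually.of_forall fun m => ?_) ?_ ?_ ?_
    · exact (measurable_const.sub ((hFm.comp (by fun_prop)).pow_const m)).aestronglyMeasurable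
    · filter_upwards [hb.eventually hright, eventually_ge_atTop 2] with m hm hm2
      filter_upwards [ae_restrict_mem measurableSet_Ioi] with t ht
      have ht : 0 < t := ht
      have hm0 : (0 : ℝ) < m := by positivity
      have h2 : (m : ℝ) * T (b m) ≤ 1 := by
        have := hspec m hm2
        rwa [le_div_iff₀ hm0, mul_comm] at this
      have h3 := one_add_mul_le_pow (a := -T (b m + t * η (b m)))
        (by linarith [hT.le_one (b m + t * η (b m))]) m
      have h4 : 0 ≤ F (b m + t * η (b m)) ^ m := pow_nonneg (hF0 _) _
      have h5 : F (b m + t * η (b m)) ^ m ≤ 1 := pow_le_one₀ (hF0 _) (hF1 _)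
      rw [Real.norm_of_nonneg (sub_nonneg.2 h5)]
      refine le_min (by linarith) ?_
      have hCt : C * t ^ (-β) ≤ |C| * t ^ (-β) :=
        mul_le_mul_of_nonneg_right (le_abs_self C) (by positivity)
      have h6 : (m : ℝ) * T (b m + t * η (b m)) ≤ |C| * t ^ (-β) := by
        calc (m : ℝ) * T (b m + t * η (b m)) ≤ m * (|C| * t ^ (-β) * T (b m)) :=
              mul_le_mul_of_nonneg_left ((hm.2 t ht).trans
                (mul_le_mul_of_nonneg_right hCt (hT.nonneg _))) hm0.le
          _ = |C| * t ^ (-β) * (m * T (b m)) := by ring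
          _ ≤ |C| * t ^ (-β) * 1 := mul_le_mul_of_nonneg_left h2 (by positivity)
          _ = |C| * t ^ (-β) := mul_one _
      rw [hF, sub_eq_add_neg 1 (T _)]
      linarith
    · rw [← IntegrableOn, ← Ioc_union_Ioi_eq_Ioi zero_le_one]
      have hmeas : Measurable fun t : ℝ => min 1 (|C| * t ^ (-β)) := by fun_prop
      refine IntegrableOn.union ?_ ?_
      · refine Measure.integrableOn_of_bounded (M := 1) (by simp) hmeas.aestronglyMeasurable ?_
        filter_upwards [ae_restrict_mem measurableSet_Ioc] with t ht
        have ht : 0 < t := ht.1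
        rw [Real.norm_of_nonneg (le_min zero_le_one (by positivity))]
        exact min_le_left _ _
      · have hdom : IntegrableOn (fun t : ℝ => |C| * t ^ (-β)) (Ioi 1) :=
          (integrableOn_Ioi_rpow_of_lt (by linarith) one_pos).const_mul _
        refine Integrable.mono' hdom hmeas.aestronglyMeasurable ?_
        filter_upwards [ae_restrict_mem measurableSet_Ioi] with t ht
        have ht : 0 < t := one_pos.trans ht
        rw [Real.norm_of_nonneg (le_min zero_le_one (by positivity))]
        exact min_le_right _ _
    · filter_upwards [hne] with t ht using (hlim t ht.2).const_sub 1
  · refine tendsto_integral_filter_of_dominated_convergence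
      (fun t => Real.exp (-(c / 2) * t ^ γ)) (Eventually.of_forall fun m => ?_) ?_ ?_ ?_
    · exact ((hFm.comp (by fun_prop)).pow_const m).aestronglyMeasurable
    · filter_upwards [hb.eventually hleft, h1.eventually (lt_mem_nhds one_half_lt_one),
        eventually_ge_atTop 1] with m hm h2 hm1
      filter_upwards [ae_restrict_mem measurableSet_Ioi] with t ht
      have ht : 0 < t := ht
      rw [Real.norm_of_nonneg (pow_nonneg (hF0 _) _)]
      have heq : b m + -t * η (b m) = b m - t * η (b m) := by ring
      by_cases hpos : 0 ≤ b m - t * η (b m)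
      · have h3 := hm t ht hpos
        rw [heq]
        calc F (b m - t * η (b m)) ^ m ≤ Real.exp (-T (b m - t * η (b m))) ^ m :=
              pow_le_pow_left₀ (hF0 _) (by rw [hF]; exact Real.one_sub_le_exp_neg _) m
          _ = Real.exp (m * -T (b m - t * η (b m))) := (Real.exp_nat_mul _ _).symm
          _ ≤ Real.exp (-(c / 2) * t ^ γ) := by
            refine Real.exp_le_exp.2 ?_
            have h4 := mul_le_mul_of_nonneg_left h3 (Nat.cast_nonneg (α := ℝ) m)
            have h5 : 0 ≤ c * t ^ γ := by positivity
            change 1 / 2 < (m : ℝ) * T (b m) at h2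
            nlinarith
      · rw [heq, hF, hT.eq_one_of_neg _ (not_le.1 hpos), sub_self, zero_pow (by omega)]
        positivity
    · have := integrableOn_rpow_mul_exp_neg_mul_rpow (p := γ) (s := 0) (b := c / 2) (by norm_num)
        hγ (by positivity)
      simpa [IntegrableOn] using this
    · filter_upwards [hne] with t ht using hlim (-t) (by rw [abs_neg]; exact ht.2)

end IsTailFunction

/-- For a sample of size `m`, the normalized expectation of the maximum as a difference of
integrals. -/
theorem IsIIDSample.integral_sampleMax {Ω : Type*} [MeasurableSpace Ω] {μ : Measure Ω}
    [IsProbabilityMeasure μ] {F : ℝ → ℝ} {m : ℕ} {Y : Fin m → Ω → ℝ} (hY : IsIIDSample μ F Y)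
    (hint : Integrable (sampleMax Y) μ) (hm : m ≠ 0) {a : ℝ} (ha : 0 < a) (b : ℝ) :
    ((∫ ω, sampleMax Y ω ∂μ) - b) / a =
      (∫ t in Ioi (0 : ℝ), (1 - F (b + t * a) ^ m)) - ∫ t in Ioi (0 : ℝ), F (b + -t * a) ^ m := by
  have hmeas := hY.measurable_sampleMax
  rw [← integral_eq_of_cdf (Z := fun ω => (sampleMax Y ω - b) / a)
    ((hmeas.sub_const b).div_const a) ((hint.sub (integrable_const b)).div_const a)
    (H := fun t => F (b + t * a) ^ m), integral_div, integral_sub hint (integrable_const b)]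
  · simp
  · intro y
    rw [← hY.measureReal_sampleMax_le hm]
    congr 1
    ext ω
    simp only [mem_ofPred_eq, div_le_iff₀ ha, sub_le_iff_le_add, add_comm b]

/-! ### Expectations of the extreme value laws -/

/-- The standard exponential law, as a density on the positive half-line. If `ω` has this law, then
`-log ω`, `ω ^ (-1 / α)` and `-ω ^ (1 / α)` have the three extreme value laws. -/
noncomputable def expLaw : Measure ℝ :=
  (volume.restrict (Ioi 0)).withDensity fun x => ENNReal.ofReal (Real.exp (-x))

theorem ae_expLaw_pos : ∀ᵐ ω ∂expLaw, 0 < ω :=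
  (withDensity_absolutelyContinuous _ _).ae_le (ae_restrict_mem measurableSet_Ioi)

theorem expLaw_Ici {x : ℝ} (hx : 0 ≤ x) : expLaw (Ici x) = ENNReal.ofReal (Real.exp (-x)) := by
  rw [expLaw, withDensity_apply _ measurableSet_Ici, Measure.restrict_restrict measurableSet_Ici]
  have h1 : (Ici x ∩ Ioi 0 : Set ℝ) =ᵐ[volume] Ioi x := by
    rcases hx.eq_or_lt with rfl | hx
    · have : (Ici 0 ∩ Ioi 0 : Set ℝ) = Ioi 0 := inter_eq_right.2 Ioi_subset_Ici_self
      simp only [this]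
      exact ae_eq_rfl
    · have : (Ici x ∩ Ioi 0 : Set ℝ) = Ici x := inter_eq_left.2 fun y hy => hx.trans_le hy
      rw [this]
      exact Ioi_ae_eq_Ici.symm
  rw [Measure.restrict_congr_set h1, ← ofReal_integral_eq_lintegral_ofReal
    (by simpa [IntegrableOn] using integrableOn_exp_neg_Ioi x)
    (Eventually.of_forall fun _ => (Real.exp_pos _).le), integral_exp_neg_Ioi]

instance : IsProbabilityMeasure expLaw := ⟨by
  rw [← show expLaw (Ici 0) = 1 by simpa using expLaw_Ici le_rfl]
  refine measure_congr ?_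
  filter_upwards [ae_expLaw_pos] with ω hω
  exact propext ⟨fun _ => hω.le, fun _ => trivial⟩⟩

/-- The law of a function of `ω` can be read off from a description of its sublevel sets by
`x ≤ ω`. -/
theorem expLaw_measureReal_le {Z : ℝ → ℝ} {x y : ℝ} (hx : 0 ≤ x)
    (h : ∀ ω, 0 < ω → (Z ω ≤ y ↔ x ≤ ω)) : expLaw.real {ω | Z ω ≤ y} = Real.exp (-x) := by
  have h1 : {ω | Z ω ≤ y} =ᵐ[expLaw] Ici x := by
    filter_upwards [ae_expLaw_pos] with ω hω
    exact propext (h ω hω)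
  rw [measureReal_congr h1, measureReal_def, expLaw_Ici hx,
    ENNReal.toReal_ofReal (Real.exp_pos _).le]

theorem integral_expLaw (f : ℝ → ℝ) :
    ∫ ω, f ω ∂expLaw = ∫ x in Ioi (0 : ℝ), Real.exp (-x) * f x := by
  rw [expLaw, integral_withDensity_eq_integral_toReal_smul (by fun_prop) (by simp)]
  simp [ENNReal.toReal_ofReal (Real.exp_pos _).le]

theorem integrable_expLaw {f : ℝ → ℝ}
    (h : IntegrableOn (fun x => Real.exp (-x) * f x) (Ioi 0)) : Integrable f expLaw := by
  rw [expLaw, integrable_withDensity_iff_integrable_smul' (by fun_prop) (by simp)]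
  simpa [ENNReal.toReal_ofReal (Real.exp_pos _).le, IntegrableOn] using h

theorem expLaw_neg_log (y : ℝ) : expLaw.real {ω | -Real.log ω ≤ y} = gumbelCDF y :=
  expLaw_measureReal_le (Real.exp_pos _).le fun ω hω => by
    rw [neg_le, ← Real.le_log_iff_exp_le hω]

theorem expLaw_rpow_neg {α : ℝ} (hα : 0 < α) (y : ℝ) :
    expLaw.real {ω | ω ^ (-(1 / α)) ≤ y} = frechetCDF α y := by
  rw [frechetCDF]
  split_ifs with hy
  · rw [← measureReal_empty (μ := expLaw)]
    refine measureReal_congr ?_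
    filter_upwards [ae_expLaw_pos] with ω hω
    exact propext ⟨fun h => absurd (Real.rpow_pos_of_pos hω _) (not_lt.2 (le_trans h hy)),
      fun h => h.elim⟩
  · have hy : 0 < y := not_le.1 hy
    refine expLaw_measureReal_le (by positivity) fun ω hω => ?_
    have h1 : y = (y ^ (-α)) ^ (-(1 / α)) := by
      rw [← Real.rpow_mul hy.le]
      field_simp
      simp
    conv_lhs => rw [h1]
    exact Real.rpow_le_rpow_iff_of_neg hω (by positivity) (by simpa using hα)

theorem expLaw_neg_rpow {α : ℝ} (hα : 0 < α) (y : ℝ) :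
    expLaw.real {ω | -ω ^ (1 / α) ≤ y} = reversedWeibullCDF α y := by
  rw [reversedWeibullCDF]
  split_ifs with hy
  · have hy' : 0 < -y := neg_pos.2 hy
    refine expLaw_measureReal_le (by positivity) fun ω hω => ?_
    have h1 : -y = ((-y) ^ α) ^ (1 / α) := by
      rw [← Real.rpow_mul hy'.le, mul_one_div_cancel hα.ne', Real.rpow_one]
    rw [neg_le]
    conv_lhs => rw [h1]
    exact Real.rpow_le_rpow_iff (by positivity) hω.le (by positivity)
  · have := expLaw_measureReal_le (Z := fun ω => -ω ^ (1 / α)) (y := y) le_rfl fun ω hω =>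
      ⟨fun _ => hω.le, fun _ => by
        have : 0 < ω ^ (1 / α) := Real.rpow_pos_of_pos hω _
        linarith⟩
    simpa using this

/-- `Γ'(1) = -γ`, differentiating under the integral sign. -/
theorem integral_log_mul_exp_neg :
    ∫ x in Ioi (0 : ℝ), Real.exp (-x) * Real.log x = -Real.eulerMascheroniConstant := by
  have h1 := Complex.hasDerivAt_GammaIntegral (s := 1) (by simp)
  have h2 : HasDerivAt Complex.Gamma
      (∫ t : ℝ in Ioi 0, (t : ℂ) ^ ((1 : ℂ) - 1) * (Real.log t * Real.exp (-t))) 1 := by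
    refine h1.congr_of_eventuallyEq ?_
    have : ∀ᶠ s : ℂ in 𝓝 1, 0 < s.re :=
      Complex.continuous_re.continuousAt.eventually (lt_mem_nhds (by simp))
    filter_upwards [this] with s hs using Complex.Gamma_eq_integral hs
  have h3 := h2.unique Complex.hasDerivAt_Gamma_one
  have h4 : (∫ t : ℝ in Ioi 0, (t : ℂ) ^ ((1 : ℂ) - 1) * (Real.log t * Real.exp (-t))) =
      ((∫ x in Ioi (0 : ℝ), Real.exp (-x) * Real.log x : ℝ) : ℂ) := by
    rw [← integral_complex_ofReal]
    refine setIntegral_congr_fun measurableSet_Ioi fun x _ => ?_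
    push_cast
    simp [mul_comm]
  rw [h4] at h3
  exact_mod_cast h3

theorem integrable_log_expLaw : Integrable Real.log expLaw := by
  refine integrable_expLaw ?_
  by_contra h
  have h1 := integral_log_mul_exp_neg
  rw [integral_undef h] at h1
  linarith [Real.one_half_lt_eulerMascheroniConstant]

theorem integral_gumbel :
    (∫ t in Ioi (0 : ℝ), (1 - gumbelCDF t)) - ∫ t in Ioi (0 : ℝ), gumbelCDF (-t) =
      Real.eulerMascheroniConstant := by
  rw [← integral_eq_of_cdf Real.measurable_log.neg integrable_log_expLaw.neg expLaw_neg_log]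
  simp only [Pi.neg_apply, integral_neg]
  rw [integral_expLaw, integral_log_mul_exp_neg, neg_neg]

theorem integrable_rpow_expLaw {s : ℝ} (hs : 0 < 1 + s) :
    Integrable (fun ω => ω ^ s) expLaw := by
  refine integrable_expLaw ?_
  simpa using Real.GammaIntegral_convergent hs

theorem integral_rpow_expLaw {s : ℝ} (hs : 0 < 1 + s) :
    ∫ ω, ω ^ s ∂expLaw = Real.Gamma (1 + s) := by
  rw [integral_expLaw, Real.Gamma_eq_integral hs]
  simp

/-- The Fréchet law, centred at `1`. -/
theorem integral_frechet {α : ℝ} (hα : 1 < α) :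
    (∫ t in Ioi (0 : ℝ), (1 - frechetCDF α (1 + t))) -
      ∫ t in Ioi (0 : ℝ), frechetCDF α (1 + -t) = Real.Gamma (1 - 1 / α) - 1 := by
  have hα0 : 0 < α := by linarith
  have hs : 0 < 1 + -(1 / α) := by
    have : 1 / α < 1 := (div_lt_one hα0).2 hα
    linarith
  rw [← integral_eq_of_cdf (Z := fun ω : ℝ => ω ^ (-(1 / α)) - 1) (μ := expLaw)
    (H := fun t => frechetCDF α (1 + t)) (by fun_prop)
    ((integrable_rpow_expLaw hs).sub (integrable_const 1)) (fun y => by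
      simp only [sub_le_iff_le_add, add_comm y]
      exact expLaw_rpow_neg hα0 _),
    integral_sub (integrable_rpow_expLaw hs) (integrable_const 1), integral_rpow_expLaw hs]
  simp [sub_eq_add_neg]

/-- The reversed Weibull law, centred at `-1`. -/
theorem integral_reversedWeibull {α : ℝ} (hα : 0 < α) :
    (∫ t in Ioi (0 : ℝ), (1 - reversedWeibullCDF α (-1 + t))) -
      ∫ t in Ioi (0 : ℝ), reversedWeibullCDF α (-1 + -t) = 1 - Real.Gamma (1 + 1 / α) := by
  have hs : 0 < 1 + 1 / α := by positivity
  rw [← integral_eq_of_cdf (Z := fun ω : ℝ => 1 - ω ^ (1 / α)) (μ := expLaw)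
    (H := fun t => reversedWeibullCDF α (-1 + t)) (by fun_prop)
    ((integrable_const 1).sub (integrable_rpow_expLaw hs)) (fun y => by
      rw [← expLaw_neg_rpow hα]
      congr 1
      ext ω
      simp only [mem_ofPred_eq]
      constructor <;> intro h <;> linarith),
    integral_sub (integrable_const 1) (integrable_rpow_expLaw hs), integral_rpow_expLaw hs]
  simp

theorem gammaIntegral_eq_lintegral_frechet {α : ℝ} (hα : 0 < α) :
    gammaIntegral (1 - 1 / α) =
      ∫⁻ t in Ioi (0 : ℝ), ENNReal.ofReal (1 - frechetCDF α t) := by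
  rw [← lintegral_ofReal_eq_of_cdf (Z := fun ω : ℝ => ω ^ (-(1 / α))) (by fun_prop)
    (expLaw_rpow_neg hα), expLaw, lintegral_withDensity_eq_lintegral_mul _ (by fun_prop)
    (by fun_prop), gammaIntegral]
  refine setLIntegral_congr_fun measurableSet_Ioi fun x _ => ?_
  simp only [Pi.mul_apply]
  rw [← ENNReal.ofReal_mul (Real.exp_pos _).le, mul_comm, show 1 - 1 / α - 1 = -(1 / α) by ring]

theorem gammaIntegral_eq_ofReal {s : ℝ} (hs : 0 < s) :
    gammaIntegral s = ENNReal.ofReal (Real.Gamma s) := by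
  rw [Real.Gamma_eq_integral hs, ofReal_integral_eq_lintegral_ofReal
    (Real.GammaIntegral_convergent hs), gammaIntegral]
  · simp only [mul_comm]
  · filter_upwards [ae_restrict_mem measurableSet_Ioi] with x hx
    have hx : 0 < x := hx
    simp only [Pi.zero_apply]
    positivity

theorem gammaIntegral_eq_top {s : ℝ} (hs : s ≤ 0) : gammaIntegral s = ⊤ := by
  by_contra hne
  have h1 : IntegrableOn (fun x : ℝ => x ^ (s - 1) * Real.exp (-x)) (Ioi 0) := by
    refine ⟨Measurable.aestronglyMeasurable (by fun_prop), ?_⟩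
    rw [hasFiniteIntegral_iff_ofReal]
    · exact lt_top_iff_ne_top.2 hne
    · filter_upwards [ae_restrict_mem measurableSet_Ioi] with x hx
      have hx : 0 < x := hx
      simp only [Pi.zero_apply]
      positivity
  have h2 : IntegrableOn (fun x : ℝ => x ^ (s - 1)) (Ioo 0 1) := by
    refine Integrable.mono' ((h1.mono_set Ioo_subset_Ioi_self).const_mul (Real.exp 1))
      (Measurable.aestronglyMeasurable (by fun_prop)) ?_
    filter_upwards [ae_restrict_mem measurableSet_Ioo] with x hx
    have hx0 : 0 < x := hx.1
    have hp : 0 < x ^ (s - 1) := by positivity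
    rw [Real.norm_of_nonneg hp.le, mul_left_comm, ← Real.exp_add]
    have : 1 ≤ Real.exp (1 + -x) := Real.one_le_exp (by linarith [hx.2])
    nlinarith
  have h3 := (intervalIntegral.integrableOn_Ioo_rpow_iff one_pos).1 h2
  linarith

/-! ### The residual execution time -/

theorem isTailFunction_cdf (ν : Measure ℝ) [IsProbabilityMeasure ν] (hν : ν (Iio 0) = 0) :
    IsTailFunction fun x => 1 - cdf ν x where
  antitone x y hxy := sub_le_sub_left (monotone_cdf ν hxy) 1
  right_cont x := continuousWithinAt_const.sub ((cdf ν).right_continuous x)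
  eq_one_of_neg x hx := by
    have : ν.real (Iic x) = 0 :=
      measureReal_mono_null (Iic_subset_Iio.2 hx) (by simp [measureReal_def, hν])
    simp [cdf_eq_real, this]
  tendsto_zero := by simpa using (tendsto_cdf_atTop ν).const_sub 1

theorem isTailFunction_residualTail (ν : Measure ℝ) [IsProbabilityMeasure ν] (hν : ν (Iio 0) = 0)
    {p : ℝ} (hp0 : 0 < p) (hp1 : p < 1) (r l : ℕ) :
    IsTailFunction (residualTail (cdf ν) p r l) := by
  have hS := isTailFunction_cdf ν hν
  have hq := (hS.quantile_spec (F := cdf ν) (fun x => by ring) (u := 1 - p) (by linarith)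
    (by linarith)).1
  set q := quantile (cdf ν) (1 - p)
  set S : ℝ → ℝ := fun x => 1 - cdf ν x with hSdef
  set R : ℝ → ℝ := fun y => if l = 0 then S y ^ (r + 1) else 1 / p * S y ^ r * S (y + q) with hR
  have hres : residualTail (cdf ν) p r l = fun y => if y < 0 then 1 else R y := rfl
  have hRanti : Antitone R := by
    intro x y hxy
    simp only [hR]
    have h1 := hS.antitone hxy
    have h2 := hS.antitone (show x + q ≤ y + q by linarith)
    have h3 := hS.nonneg y
    have h4 := hS.nonneg (y + q)
    have h5 := hS.nonneg x
    split_ifs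
    · exact pow_le_pow_left₀ h3 h1 _
    · gcongr
  have hR1 : ∀ y, 0 ≤ y → R y ≤ 1 := by
    intro y hy
    simp only [hR]
    have h1 := hS.le_one y
    have h3 := hS.nonneg y
    split_ifs
    · exact pow_le_one₀ h3 h1
    · have h4 : S (y + q) ≤ p := (hS.antitone (show q ≤ y + q by linarith)).trans (by linarith)
      calc 1 / p * S y ^ r * S (y + q) ≤ 1 / p * 1 * p := by
            gcongr
            · exact hS.nonneg _
            · exact pow_le_one₀ h3 h1
        _ = 1 := by field_simp
  have hRcont : ∀ x, ContinuousWithinAt R (Ici x) x := by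
    intro x
    have h1 := hS.right_cont x
    have h2 : ContinuousWithinAt (fun y => S (y + q)) (Ici x) x :=
      ContinuousWithinAt.comp (g := S) (f := fun y => y + q) (t := Ici (x + q))
        (hS.right_cont (x + q)) (by fun_prop) fun y hy => add_le_add_left (mem_Ici.1 hy) q
    simp only [hR]
    split_ifs
    · exact h1.pow _
    · exact (continuousWithinAt_const.mul (h1.pow r)).mul h2
  have hRlim : Tendsto R atTop (𝓝 0) := by
    have h1 := hS.tendsto_zero
    have h2 : Tendsto (fun y => S (y + q)) atTop (𝓝 0) :=
      h1.comp (tendsto_atTop_add_const_right _ q tendsto_id)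
    simp only [hR]
    split_ifs
    · simpa using h1.pow (r + 1)
    · simpa using (tendsto_const_nhds.mul (h1.pow r)).mul h2
  rw [hres]
  refine ⟨fun x y hxy => ?_, fun x => ?_, fun x hx => if_pos hx, ?_⟩
  · split_ifs with h1 h2 h2
    · exact le_rfl
    · exact absurd (hxy.trans_lt h1) h2
    · exact hR1 y (not_lt.1 h1)
    · exact hRanti hxy
  · rcases lt_or_ge x 0 with hx | hx
    · refine (continuousAt_const (y := (1 : ℝ))).continuousWithinAt.congr_of_eventuallyEq ?_
        (if_pos hx)
      filter_upwards [nhdsWithin_le_nhds (gt_mem_nhds hx)] with y hy using if_pos hy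
    · exact (hRcont x).congr (fun y hy => if_neg (not_lt.2 (hx.trans hy))) (if_neg (not_lt.2 hx))
  · refine hRlim.congr' ?_
    filter_upwards [eventually_ge_atTop 0] with y hy using (if_neg (not_lt.2 hy)).symm

/-! ### The three cases -/

/-- Polynomial bounds on the tail, to the right integrable and to the left nontrivial, on the scale
of the auxiliary function `η`. -/
structure HasTailBounds (T η : ℝ → ℝ) : Prop where
  right : ∃ C β : ℝ, 1 < β ∧
    ∀ᶠ x in tailFilter T, 0 < η x ∧ ∀ t > 0, T (x + t * η x) ≤ C * t ^ (-β) * T x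
  left : ∃ c γ : ℝ, 0 < c ∧ 0 < γ ∧ ∀ᶠ x in tailFilter T, ∀ s > 0, 0 ≤ x - s * η x →
    c * s ^ γ * T x ≤ T (x - s * η x)

theorem HasTailBounds.integrableOn {T η : ℝ → ℝ} (hb : HasTailBounds T η) (hT : IsTailFunction T)
    (hs : HasSmallValues T) : IntegrableOn T (Ioi 0) := by
  obtain ⟨C, β, hβ, h⟩ := hb.right
  have := hT.neBot_tailFilter hs
  obtain ⟨x, hx, hC⟩ := h.exists
  exact hT.integrableOn_of_bound hx hβ hC

/-- Convergence of the normalized expectations of the maxima of samples whose sizes tend to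
infinity. -/
theorem HasTailBounds.tendsto_expectation {T η : ℝ → ℝ} (hb : HasTailBounds T η)
    (hT : IsTailFunction T) (hs : HasSmallValues T) {F : ℝ → ℝ} (hF : ∀ x, F x = 1 - T x)
    {G L : ℝ → ℝ} {D : Set ℝ} (h : HasTailLimit T η D L) (hD : D ∈ 𝓝 0) (hL : ContinuousAt L 0)
    (hlim : ∀ t, |t| ≠ 1 → Tendsto (fun m : ℕ => F (quantile F (1 - 1 / (m : ℝ)) +
      t * η (quantile F (1 - 1 / (m : ℝ)))) ^ m) atTop (𝓝 (G t)))
    {N : ℕ → ℕ} (hN : Tendsto N atTop atTop) {Ω : ℕ → Type*} [∀ n, MeasurableSpace (Ω n)]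
    {μ : ∀ n, Measure (Ω n)} [∀ n, IsProbabilityMeasure (μ n)]
    {Y : ∀ n, Fin (N n) → Ω n → ℝ} (hY : ∀ n, IsIIDSample (μ n) F (Y n)) :
    Tendsto (fun n => ((∫ ω, sampleMax (Y n) ω ∂(μ n)) - quantile F (1 - 1 / (N n : ℝ))) /
        η (quantile F (1 - 1 / (N n : ℝ)))) atTop
      (𝓝 ((∫ t in Ioi (0 : ℝ), (1 - G t)) - ∫ t in Ioi (0 : ℝ), G (-t))) := by
  have hint := hb.integrableOn hT hs
  obtain ⟨C, β, hβ, hright⟩ := hb.right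
  obtain ⟨c, γ, hc, hγ, hleft⟩ := hb.left
  refine ((hT.tendsto_integral_sub_integral hs hF hβ hc hγ hright hleft
    (hT.tendsto_mul_quantile hs hF h hD hL) hlim).comp hN).congr' ?_
  filter_upwards [hN.eventually_ne_atTop 0,
    hN.eventually ((hT.tendsto_quantile hs hF).eventually h.pos)] with n hn hpos
  exact ((hY n).integral_sampleMax ((hY n).integrable_sampleMax hT hF hint) hn hpos _).symm

namespace IsTailFunction

variable {T : ℝ → ℝ}

theorem hasTailBounds_gumbel (hT : IsTailFunction T) (hs : HasSmallValues T) {η : ℝ → ℝ}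
    (h : HasTailLimit T η univ fun t => Real.exp (-t)) : HasTailBounds T η := by
  have hanti : StrictAntiOn (fun t : ℝ => Real.exp (-t)) univ := fun s _ t _ hst =>
    Real.exp_lt_exp.2 (neg_lt_neg hst)
  have he := Real.exp_one_gt_d9
  have hr1 := hT.tendsto_aux_shift isOpen_univ h hanti (t := 1) (u := 1) (v := 2) trivial trivial
    trivial (Real.exp_pos _) one_ne_zero (by rw [← Real.exp_add]; norm_num)
  have hr2 := hT.tendsto_aux_shift isOpen_univ h hanti (t := -1) (u := 1) (v := 0) trivial trivial
    trivial (Real.exp_pos _) one_ne_zero (by rw [← Real.exp_add]; norm_num)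
  have hlt1 : ((2 - 1) / 1 : ℝ) < 3 / 2 := by norm_num
  have hlt2 : ((0 - -1) / 1 : ℝ) < 3 / 2 := by norm_num
  constructor
  · -- a step forward multiplies the tail by about `1 / e < (3 / 2) ^ (-2)`
    have h1 : Real.exp (-1) < (3 / 2 : ℝ) ^ (-2 : ℝ) := by
      rw [Real.exp_neg, Real.rpow_neg (by norm_num)]
      refine inv_strictAnti₀ (by positivity) ?_
      norm_num
      linarith
    obtain ⟨C, -, hC⟩ := hT.eventually_tail_le hs (η := η) (ρ := 3 / 2) (β := 2) (by norm_num)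
      two_pos (by
        filter_upwards [h.pos, eventually_pos_tailFilter,
          (h.tendsto 1 trivial).eventually (gt_mem_nhds h1), hr1.eventually (gt_mem_nhds hlt1)]
          with x h2 h3 h4 h5
        rw [div_lt_iff₀ h3, one_mul] at h4
        rw [div_lt_iff₀ h2, one_mul] at h5
        exact ⟨h2, h4.le, h5.le⟩)
    exact ⟨C, 2, one_lt_two, hC⟩
  · -- a step backward multiplies the tail by about `e > 3 / 2`
    have h1 : (3 / 2 : ℝ) ^ (1 : ℝ) < Real.exp (- -1) := by
      rw [neg_neg, Real.rpow_one]
      linarith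
    obtain ⟨c, hc, h2⟩ := hT.eventually_le_tail hs (η := η) (ρ := 3 / 2) (β := 1) (by norm_num)
      one_pos (by
        filter_upwards [h.pos, eventually_pos_tailFilter,
          (h.tendsto (-1) trivial).eventually (lt_mem_nhds h1), hr2.eventually (gt_mem_nhds hlt2)]
          with x h2 h3 h4 h5
        rw [lt_div_iff₀ h3, neg_one_mul, ← sub_eq_add_neg] at h4
        rw [div_lt_iff₀ h2, neg_one_mul, ← sub_eq_add_neg] at h5
        exact ⟨h2, h4.le, h5.le⟩)
    exact ⟨c, 1, hc, one_pos, h2⟩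

theorem hasTailBounds_frechet (hT : IsTailFunction T) (hs : HasSmallValues T) {α : ℝ} (hα : 1 < α)
    (h : HasTailLimit T id (Ioi (-1)) fun t => (1 + t) ^ (-α)) : HasTailBounds T id := by
  constructor
  · have h1 : (1 + 1 : ℝ) ^ (-α) < 2 ^ (-((1 + α) / 2)) := by
      rw [one_add_one_eq_two]
      exact Real.rpow_lt_rpow_of_exponent_lt one_lt_two (by linarith)
    obtain ⟨C, -, hC⟩ := hT.eventually_tail_le hs (η := id) (ρ := 2) (β := (1 + α) / 2) one_lt_two
      (by linarith) (by
        filter_upwards [h.pos, eventually_pos_tailFilter,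
          (h.tendsto 1 (by simp)).eventually (gt_mem_nhds h1)] with x h2 h3 h4
        rw [div_lt_iff₀ h3, one_mul] at h4
        exact ⟨h2, h4.le, by simp only [id]; linarith⟩)
    exact ⟨C, _, by linarith, hC⟩
  · -- the origin is at distance `η(x) = x`, so only `s ≤ 1` matters
    refine ⟨1, 1, one_pos, one_pos, ?_⟩
    filter_upwards [h.pos] with x hx s hs0 hxs
    simp only [id] at hx hxs ⊢
    have hs1 : s ≤ 1 := by nlinarith
    have h1 : T x ≤ T (x - s * x) := hT.antitone (by nlinarith)
    rw [Real.rpow_one, one_mul]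
    nlinarith [hT.nonneg x]

theorem hasTailBounds_reversedWeibull (hT : IsTailFunction T) (hs : HasSmallValues T) {α xF : ℝ}
    (hα : 0 < α) (hxF : ∀ x, 0 < T x ↔ x < xF)
    (h : HasTailLimit T (fun x => xF - x) (Iio 1) fun t => (1 - t) ^ α) :
    HasTailBounds T fun x => xF - x := by
  constructor
  · -- the end point is at distance `η(x) = xF - x`, so only `t < 1` matters
    refine ⟨1, 2, one_lt_two, ?_⟩
    filter_upwards [h.pos] with x hx
    refine ⟨hx, fun t ht => ?_⟩
    rw [one_mul]
    rcases lt_or_ge t 1 with ht1 | ht1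
    · have h1 : T (x + t * (xF - x)) ≤ T x := hT.antitone (by nlinarith)
      have h2 : 1 ≤ t ^ (-2 : ℝ) :=
        Real.one_le_rpow_of_pos_of_le_one_of_nonpos ht ht1.le (by norm_num)
      nlinarith [hT.nonneg x]
    · have h1 : T (x + t * (xF - x)) ≤ 0 :=
        not_lt.1 fun hlt => by
          have := (hxF _).1 hlt
          nlinarith
      exact h1.trans (mul_nonneg (by positivity) (hT.nonneg x))
  · have h1 : (2 : ℝ) ^ (α / 2) < (1 - -1) ^ α := by
      rw [show (1 - -1 : ℝ) = 2 by norm_num]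
      exact Real.rpow_lt_rpow_of_exponent_lt one_lt_two (by linarith)
    obtain ⟨c, hc, h2⟩ := hT.eventually_le_tail hs (η := fun x => xF - x) (ρ := 2) (β := α / 2)
      one_lt_two (by positivity) (by
        filter_upwards [h.pos, eventually_pos_tailFilter,
          (h.tendsto (-1) (by simp)).eventually (lt_mem_nhds h1)] with x h2 h3 h4
        rw [lt_div_iff₀ h3, neg_one_mul, ← sub_eq_add_neg] at h4
        exact ⟨h2, h4.le, by linarith⟩)
    exact ⟨c, α / 2, hc, by positivity, h2⟩

/-- In `IsAuxiliaryFunction` the limit is taken along left neighbourhoods of the end point in the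
extended reals; these form `tailFilter T`. -/
theorem hasTailLimit_of_isAuxiliaryFunction (hT : IsTailFunction T) (hs : HasSmallValues T)
    {F η : ℝ → ℝ} (hF : ∀ x, F x = 1 - T x) (h : IsAuxiliaryFunction F η) :
    HasTailLimit T η univ fun t => Real.exp (-t) := by
  constructor
  · filter_upwards [eventually_pos_tailFilter] with x hx
    exact h.1 x ((hT.coe_lt_upperEndpoint_iff hF x).2 hx)
  · intro t _
    have := h.2 t
    rw [hT.comap_nhdsLT_eq_tailFilter hs hF] at this
    simpa [hF] using this

theorem exists_isAuxiliaryFunction (hT : IsTailFunction T) (hs : HasSmallValues T)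
    {F η : ℝ → ℝ} (hF : ∀ x, F x = 1 - T x) (h : HasTailLimit T η univ fun t => Real.exp (-t)) :
    ∃ η, IsAuxiliaryFunction F η := by
  refine ⟨fun x => if 0 < η x then η x else 1, fun x _ => ?_, fun t => ?_⟩
  · dsimp only
    split_ifs with hx
    exacts [hx, one_pos]
  · rw [hT.comap_nhdsLT_eq_tailFilter hs hF]
    refine (h.tendsto t trivial).congr' ?_
    filter_upwards [h.pos] with x hx
    simp [hF, hx]

section Frechet

variable {α : ℝ} {F : ℝ → ℝ}

theorem tendsto_pow_frechet (hT : IsTailFunction T) (hs : HasSmallValues T)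
    (hF : ∀ x, F x = 1 - T x) (h : HasTailLimit T id (Ioi (-1)) fun t => (1 + t) ^ (-α)) {t : ℝ}
    (ht : t ≠ -1) :
    Tendsto (fun m : ℕ => F (quantile F (1 - 1 / (m : ℝ)) +
      t * id (quantile F (1 - 1 / (m : ℝ)))) ^ m) atTop (𝓝 (frechetCDF α (1 + t))) := by
  rcases lt_or_gt_of_ne ht with ht | ht
  · rw [frechetCDF, if_pos (by linarith)]
    refine tendsto_const_nhds.congr' ?_
    filter_upwards [(hT.tendsto_quantile hs hF).eventually h.pos, eventually_ne_atTop 0]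
      with m hm h0
    simp only [id] at hm ⊢
    rw [hF, hT.eq_one_of_neg _ (by nlinarith), sub_self, zero_pow h0]
  · rw [frechetCDF, if_neg (by linarith)]
    exact hT.tendsto_pow_quantile hs hF h (Ioi_mem_nhds (by norm_num))
      (continuousOn_frechet.continuousAt (Ioi_mem_nhds (by norm_num))) ht

/-- Fatou's lemma gives the divergence of the normalized expectations in the Fréchet case with
`α ≤ 1`. -/
theorem tendsto_lintegral_frechet_top (hT : IsTailFunction T) (hs : HasSmallValues T)
    (hF : ∀ x, F x = 1 - T x) (hα0 : 0 < α) (hα : α ≤ 1)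
    (h : HasTailLimit T id (Ioi (-1)) fun t => (1 + t) ^ (-α))
    {N : ℕ → ℕ} (hN : Tendsto N atTop atTop) {Ω : ℕ → Type*} [∀ n, MeasurableSpace (Ω n)]
    {μ : ∀ n, Measure (Ω n)} [∀ n, IsProbabilityMeasure (μ n)]
    {Y : ∀ n, Fin (N n) → Ω n → ℝ} (hY : ∀ n, IsIIDSample (μ n) F (Y n)) :
    Tendsto (fun n => (∫⁻ ω, ENNReal.ofReal (sampleMax (Y n) ω) ∂(μ n)) /
        ENNReal.ofReal (quantile F (1 - 1 / (N n : ℝ)))) atTop (𝓝 ⊤) := by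
  have hFm : Measurable F := by
    rw [show F = fun x => 1 - T x from funext hF]
    exact measurable_const.sub hT.antitone.measurable
  set J : ℕ → ENNReal := fun m => ∫⁻ t in Ioi (0 : ℝ),
    ENNReal.ofReal (1 - F (t * quantile F (1 - 1 / (m : ℝ))) ^ m) with hJ
  have htop : Tendsto J atTop (𝓝 ⊤) := by
    have h1 : (⊤ : ENNReal) ≤ liminf J atTop := by
      have h2 : 1 - 1 / α ≤ 0 := by
        rw [sub_nonpos, le_div_iff₀ hα0]
        linarith
      rw [← gammaIntegral_eq_top h2, gammaIntegral_eq_lintegral_frechet hα0]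
      refine le_trans (lintegral_mono_ae ?_) (lintegral_liminf_le fun m =>
        (measurable_const.sub ((hFm.comp (by fun_prop)).pow_const m)).ennreal_ofReal)
      filter_upwards [ae_restrict_mem measurableSet_Ioi] with t ht
      have ht : 0 < t := ht
      have h3 := hT.tendsto_pow_frechet hs hF h (t := t - 1) (by linarith)
      rw [add_sub_cancel] at h3
      refine (((ENNReal.tendsto_ofReal (h3.const_sub 1)).congr fun m => ?_).liminf_eq).ge
      congr 4
      simp only [id]
      ring
    exact tendsto_of_le_liminf_of_limsup_le h1 le_top
  refine (htop.comp hN).congr' ?_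
  filter_upwards [hN.eventually_ne_atTop 0,
    hN.eventually ((hT.tendsto_quantile hs hF).eventually h.pos)] with n hn hpos
  simp only [id] at hpos
  simp only [Function.comp, hJ]
  have hm := (hY n).measurable_sampleMax
  rw [← lintegral_ofReal_eq_of_cdf (μ := μ n)
    (Z := fun ω => sampleMax (Y n) ω / quantile F (1 - 1 / (N n : ℝ))) (hm.div_const _)
    (H := fun t => F (t * quantile F (1 - 1 / (N n : ℝ))) ^ N n) fun y => by
      rw [← (hY n).measureReal_sampleMax_le hn]
      simp only [div_le_iff₀ hpos]]
  simp only [ENNReal.ofReal_div_of_pos hpos]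
  simp only [div_eq_mul_inv (ENNReal.ofReal _)]
  rw [lintegral_mul_const _ hm.ennreal_ofReal]
  exact (div_eq_mul_inv _ _).symm

end Frechet

theorem tendsto_pow_reversedWeibull (hT : IsTailFunction T) (hs : HasSmallValues T) {α xF : ℝ}
    {F : ℝ → ℝ} (hα : 0 < α) (hF : ∀ x, F x = 1 - T x) (hxF : ∀ x, 0 < T x ↔ x < xF)
    (h : HasTailLimit T (fun x => xF - x) (Iio 1) fun t => (1 - t) ^ α) {t : ℝ} (ht : t ≠ 1) :
    Tendsto (fun m : ℕ => F (quantile F (1 - 1 / (m : ℝ)) +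
      t * (xF - quantile F (1 - 1 / (m : ℝ)))) ^ m) atTop
      (𝓝 (reversedWeibullCDF α (-1 + t))) := by
  rcases lt_or_gt_of_ne ht with ht | ht
  · rw [reversedWeibullCDF, if_pos (by linarith), show -(-1 + t) = 1 - t by ring]
    exact hT.tendsto_pow_quantile hs hF h (Iio_mem_nhds one_pos)
      ((continuousOn_reversedWeibull hα).continuousAt (Iio_mem_nhds one_pos)) ht
  · rw [reversedWeibullCDF, if_neg (by linarith)]
    refine tendsto_const_nhds.congr' ?_
    filter_upwards [(hT.tendsto_quantile hs hF).eventually h.pos] with m hm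
    have h0 : T (quantile F (1 - 1 / (m : ℝ)) + t * (xF - quantile F (1 - 1 / (m : ℝ)))) = 0 := by
      refine le_antisymm (not_lt.1 fun hlt => ?_) (hT.nonneg _)
      have := (hxF _).1 hlt
      nlinarith
    rw [hF, h0, sub_zero, one_pow]

theorem upperEndpoint_eq_coe (hT : IsTailFunction T) {F : ℝ → ℝ} (hF : ∀ x, F x = 1 - T x) {xF : ℝ}
    (hxF : ∀ x, 0 < T x ↔ x < xF) : upperEndpoint F = (xF : EReal) := by
  refine eq_of_forall_lt_iff fun c => ?_
  constructor
  · intro hc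
    obtain ⟨x, hcx, hx⟩ := EReal.lt_iff_exists_real_btwn.1 hc
    exact hcx.trans (EReal.coe_lt_coe_iff.2 ((hxF x).1 ((hT.coe_lt_upperEndpoint_iff hF x).1 hx)))
  · intro hc
    obtain ⟨x, hcx, hx⟩ := EReal.lt_iff_exists_real_btwn.1 hc
    exact hcx.trans ((hT.coe_lt_upperEndpoint_iff hF x).2 ((hxF x).2 (EReal.coe_lt_coe_iff.1 hx)))

end IsTailFunction

end SingleFork

theorem lemma2
    -- the law of the execution time of a task, a nonnegative random variable
    (ν : Measure ℝ) [IsProbabilityMeasure ν] (hν : ν (Set.Iio 0) = 0)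
    -- the single-fork policy
    (p : ℝ) (hp0 : 0 < p) (hp1 : p < 1) (r l : ℕ) (hl : l = 0 ∨ l = 1)
    -- the distribution function of the residual execution time
    (FY : ℝ → ℝ) (hFY : FY = SingleFork.residualCDF (cdf ν) p r l)
    -- for a job with `n` tasks: the i.i.d. residual execution times of the `pn` stragglers
    {Ω : ℕ → Type*} [∀ n, MeasurableSpace (Ω n)]
    (μ : ∀ n, Measure (Ω n)) [∀ n, IsProbabilityMeasure (μ n)]
    (Y : ∀ n, Fin (SingleFork.stragglers p n) → Ω n → ℝ)
    (hY : ∀ n, SingleFork.IsIIDSample (μ n) FY (Y n)) :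
    -- Gumbel case
    (SingleFork.InDomainOfAttraction FY SingleFork.gumbelCDF →
      (∃ η : ℝ → ℝ, SingleFork.IsAuxiliaryFunction FY η) ∧
      (∀ n, Integrable (SingleFork.sampleMax (Y n)) (μ n)) ∧
      ∀ η : ℝ → ℝ, SingleFork.IsAuxiliaryFunction FY η →
        ∀ a b : ℕ → ℝ,
          (∀ m : ℕ, a m = η (SingleFork.quantile FY (1 - 1 / (m : ℝ)))) →
          (∀ m : ℕ, b m = SingleFork.quantile FY (1 - 1 / (m : ℝ))) →
          (∀ᶠ m in atTop, 0 < a m) ∧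
          Tendsto (fun n : ℕ =>
              ((∫ ω, SingleFork.sampleMax (Y n) ω ∂(μ n)) - b (SingleFork.stragglers p n)) /
                a (SingleFork.stragglers p n))
            atTop (𝓝 Real.eulerMascheroniConstant)) ∧
    -- Fréchet case
    (∀ ξ : ℝ, 0 < ξ →
      SingleFork.InDomainOfAttraction FY (SingleFork.frechetCDF ((r + 1) * ξ)) →
        ∀ a : ℕ → ℝ,
          (∀ m : ℕ, a m = SingleFork.quantile FY (1 - 1 / (m : ℝ))) →
          (∀ᶠ m in atTop, 0 < a m) ∧
          Tendsto (fun n : ℕ =>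
              (∫⁻ ω, ENNReal.ofReal (SingleFork.sampleMax (Y n) ω) ∂(μ n)) /
                ENNReal.ofReal (a (SingleFork.stragglers p n)))
            atTop (𝓝 (SingleFork.gammaIntegral (1 - 1 / ((r + 1) * ξ)))) ∧
          (1 < (r + 1) * ξ →
            (∀ n, Integrable (SingleFork.sampleMax (Y n)) (μ n)) ∧
            Tendsto (fun n : ℕ =>
                (∫ ω, SingleFork.sampleMax (Y n) ω ∂(μ n)) / a (SingleFork.stragglers p n))
              atTop (𝓝 (Real.Gamma (1 - 1 / ((r + 1) * ξ)))))) ∧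
    -- reversed-Weibull case
    (∀ ξ : ℝ, 0 < ξ →
      SingleFork.InDomainOfAttraction FY
          (SingleFork.reversedWeibullCDF (((1 - (l : ℝ)) * r + 1) * ξ)) →
        ∃ xF : ℝ, SingleFork.upperEndpoint FY = (xF : EReal) ∧
        (∀ n, Integrable (SingleFork.sampleMax (Y n)) (μ n)) ∧
        ∀ a : ℕ → ℝ,
          (∀ m : ℕ, a m = xF - SingleFork.quantile FY (1 - 1 / (m : ℝ))) →
          (∀ᶠ m in atTop, 0 < a m) ∧
          Tendsto (fun n : ℕ =>
              (xF - ∫ ω, SingleFork.sampleMax (Y n) ω ∂(μ n)) / a (SingleFork.stragglers p n))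
            atTop (𝓝 (Real.Gamma (1 + 1 / (((1 - (l : ℝ)) * r + 1) * ξ))))) := by

  have hT := SingleFork.isTailFunction_residualTail ν hν hp0 hp1 r l
  set T := SingleFork.residualTail (cdf ν) p r l
  have hF : ∀ x, FY x = 1 - T x := fun x => by rw [hFY]; rfl
  have hN : Tendsto (SingleFork.stragglers p) atTop atTop :=
    tendsto_nat_floor_atTop.comp (tendsto_natCast_atTop_atTop.const_mul_atTop hp0)
  refine ⟨fun hDA => ?_, fun ξ hξ hDA => ?_, fun ξ hξ hDA => ?_⟩
  · obtain ⟨hs, η₀, hη₀⟩ := hT.exists_aux_gumbel hF hDA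
    have hb := hT.tendsto_quantile hs hF
    refine ⟨hT.exists_isAuxiliaryFunction hs hF hη₀, fun n => (hY n).integrable_sampleMax hT hF
      ((hT.hasTailBounds_gumbel hs hη₀).integrableOn hT hs), fun η hη a b ha hb' => ?_⟩
    have hlim := hT.hasTailLimit_of_isAuxiliaryFunction hs hF hη
    refine ⟨(hb.eventually hlim.pos).mono fun m hm => by rwa [ha], ?_⟩
    have hexp : ContinuousAt (fun t : ℝ => Real.exp (-t)) 0 := by fun_prop
    simp only [ha, hb']
    rw [← SingleFork.integral_gumbel]
    exact (hT.hasTailBounds_gumbel hs hlim).tendsto_expectation hT hs hF hlim univ_mem hexp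
      (fun t _ => hT.tendsto_pow_quantile hs hF hlim univ_mem hexp trivial) hN hY
  · have hα : 0 < ((r : ℝ) + 1) * ξ := by positivity
    set α := ((r : ℝ) + 1) * ξ
    intro a ha
    obtain ⟨hs, η₀, hη₀⟩ := hT.exists_aux_frechet hF hα hDA
    have hlim := hT.hasTailLimit_id hs hα hη₀
    have hpos : ∀ᶠ m in atTop, 0 < a m :=
      ((hT.tendsto_quantile hs hF).eventually hlim.pos).mono fun m hm => by rwa [ha]
    have hfin : 1 < α → (∀ n, Integrable (SingleFork.sampleMax (Y n)) (μ n)) ∧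
        Tendsto (fun n : ℕ =>
          (∫ ω, SingleFork.sampleMax (Y n) ω ∂(μ n)) / a (SingleFork.stragglers p n))
          atTop (𝓝 (Real.Gamma (1 - 1 / α))) := by
      intro hα1
      have hbd := hT.hasTailBounds_frechet hs hα1 hlim
      refine ⟨fun n => (hY n).integrable_sampleMax hT hF (hbd.integrableOn hT hs), ?_⟩
      have h1 := hbd.tendsto_expectation hT hs hF (G := fun t => SingleFork.frechetCDF α (1 + t))
        hlim (Ioi_mem_nhds (by norm_num))
        (SingleFork.IsTailFunction.continuousOn_frechet.continuousAt (Ioi_mem_nhds (by norm_num)))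
        (fun t ht => hT.tendsto_pow_frechet hs hF hlim (by rintro rfl; simp at ht)) hN hY
      rw [SingleFork.integral_frechet hα1] at h1
      have h2 := h1.add_const 1
      rw [sub_add_cancel] at h2
      refine h2.congr' ?_
      filter_upwards [hN.eventually hpos] with n hn
      rw [ha] at hn ⊢
      simp only [id]
      field_simp
      ring
    refine ⟨hpos, ?_, hfin⟩
    rcases le_or_gt α 1 with hα1 | hα1
    · have h2 : 1 - 1 / α ≤ 0 := by
        rw [sub_nonpos, le_div_iff₀ hα]
        linarith
      rw [SingleFork.gammaIntegral_eq_top h2]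
      simp only [ha]
      exact hT.tendsto_lintegral_frechet_top hs hF hα hα1 hlim hN hY
    · have h2 : 0 < 1 - 1 / α := by
        rw [sub_pos, div_lt_iff₀ hα]
        linarith
      rw [SingleFork.gammaIntegral_eq_ofReal h2]
      refine (ENNReal.tendsto_ofReal (hfin hα1).2).congr' ?_
      filter_upwards [hN.eventually hpos] with n hn
      rw [ENNReal.ofReal_div_of_pos hn, ofReal_integral_eq_lintegral_ofReal ((hfin hα1).1 n)
        ((hY n).sampleMax_nonneg hT hF)]
  · have hα : 0 < ((1 - (l : ℝ)) * r + 1) * ξ := by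
      rcases hl with rfl | rfl
      · norm_num
        positivity
      · simpa using hξ
    set α := ((1 - (l : ℝ)) * r + 1) * ξ
    obtain ⟨hs, η₀, hη₀⟩ := hT.exists_aux_reversedWeibull hF hα hDA
    obtain ⟨xF, hxF, hlim⟩ := hT.exists_endpoint_of_reversedWeibull hs hα hη₀
    have hbd := hT.hasTailBounds_reversedWeibull hs hα hxF hlim
    refine ⟨xF, hT.upperEndpoint_eq_coe hF hxF, fun n => (hY n).integrable_sampleMax hT hF
      (hbd.integrableOn hT hs), fun a ha => ?_⟩
    have hpos : ∀ᶠ m in atTop, 0 < a m :=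
      ((hT.tendsto_quantile hs hF).eventually hlim.pos).mono fun m hm => by rwa [ha]
    refine ⟨hpos, ?_⟩
    have h1 := hbd.tendsto_expectation hT hs hF
      (G := fun t => SingleFork.reversedWeibullCDF α (-1 + t)) hlim (Iio_mem_nhds one_pos)
      ((SingleFork.IsTailFunction.continuousOn_reversedWeibull hα).continuousAt
        (Iio_mem_nhds one_pos))
      (fun t ht => hT.tendsto_pow_reversedWeibull hs hα hF hxF hlim (by rintro rfl; simp at ht))
      hN hY
    rw [SingleFork.integral_reversedWeibull hα] at h1
    have h2 := h1.const_sub 1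
    rw [sub_sub_cancel] at h2
    refine h2.congr' ?_
    filter_upwards [hN.eventually hpos] with n hn
    rw [ha] at hn ⊢
    field_simp
    ring
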